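/- Theorem (asymptotic non-normality of the OLS Z-statistic under zero margin for Thompson Sampling). Let $0<\pi_{\min}\le\pi_{\max}<1$. For each batch size $n$, consider a two-armed bandit run for $T=2$ batches of size $n$, with actions $A_{t,i}\in\{0,1\}$ and rewards $R_{t,i}=\beta_{A_{t,i}}+\epsilon_{t,i}$ ($t\in\{1,2\}$, $1\le i\le n$), where $\beta_0,\beta_1\in\mathbb R$ do not depend on $n$. The errors $\epsilon_{t,i}$ are i.i.d. $\mathcal N(0,1)$, those of batch $t$ being independent of the history of earlier batches and of the actions of batch $t$. Given the history before batch $t$, the actions $A_{t,1},\dots,A_{t,n}$ are i.i.d. $\mathrm{Bernoulli}(\pi_t^{(n)})$, where $\pi_1^{(n)}=\tfrac12$ and $$\pi_2^{(n)}=\pi_{\min}\vee\bigl[\pi_{\max}\wedge \mathbb P(\tilde\beta_1>\tilde\beta_0\mid H_1^{(n)})\bigr].$$ Here $H_1^{(n)}=\{A_{1,i},R_{1,i}\}_{i=1}^n$, and $\mathbb P(\,\cdot\mid H_1^{(n)})$ is the Bayesian posterior for the arm means $(\tilde\beta_0,\tilde\beta_1)$ under independent $\mathcal N(0,1)$ priors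 and the $\mathcal N(0,1)$ error model. Let $\Delta=\beta_1-\beta_0$ be the margin, $N_a$ the total number of times arm $a$ is selected in the two batches, $\hat\beta^{\mathrm{OLS}}=(X^\top X)^{-1}X^\top R$ the least squares estimator computed from all $2n$ observations (the rows of $X$ being $(1-A_{t,i},A_{t,i})$), $\hat\Delta^{\mathrm{OLS}}=\hat\beta_1^{\mathrm{OLS}}-\hat\beta_0^{\mathrm{OLS}}$, and $$Z^{(n)}=\sqrt{\frac{N_1N_0}{2n}}\,\bigl(\hat\Delta^{\mathrm{OLS}}-\Delta\bigr).$$ (On the event that some $N_a=0$, set $Z^{(n)}=0$.) Suppose $\Delta=0$. Then, as $n\to\infty$, $Z^{(n)}$ converges in distribution to $$Y=\sqrt{\frac{\frac12+1-\pi_*}{2(\frac12+\pi_*)}}\Bigl(\sqrt{\tfrac12}\,Z_1+\sqrt{\pi_*}\,Z_3\Bigr)-\sqrt{\frac{\frac12+\pi_*}{2(\frac12+1-\pi_*)}}\Bigl(\sqrt{\tfrac12}\,Z_2+\sqrt{1-\pi_*}\,Z_4\Bigr),$$ where $Z_1,Z_2,Z_3,Z_4$ are i.i.d. $\mathcal N(0,1)$,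 $\pi_*=\pi_{\min}\vee\bigl(\pi_{\max}\wedge\Phi\bigl((Z_1-Z_2)/\sqrt2\bigr)\bigr)$ and $\Phi$ is the standard normal distribution function. If moreover $\pi_{\min}<\pi_{\max}$, then $Z^{(n)}$ is asymptotically not normal: for all $m\in\mathbb R$ and $v\ge0$, the law of $Y$ is not $\mathcal N(m,v)$ and $Z^{(n)}$ does not converge in distribution to $\mathcal N(m,v)$. -/

import Mathlib

open MeasureTheory ProbabilityTheory Filter
open scoped Matrix

noncomputable section

namespace BatchedBandit

/-! ### Two-armed batched bandit: `T` batches of size `n`, arms `0` and `1` -/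

section Model

variable {Ω : Type*} {T n : ℕ}

/-- The errors `ε_{t,i} = R_{t,i} - β_{A_{t,i}}` (stationary mean rewards `β 0`, `β 1`). -/
def err (β : Fin 2 → ℝ) (A : Fin T → Fin n → Ω → Fin 2) (R : Fin T → Fin n → Ω → ℝ)
    (t : Fin T) (ω : Ω) (i : Fin n) : ℝ :=
  R t i ω - β (A t i ω)

/-- All actions and rewards of the batches strictly before batch `t`. -/
def history (A : Fin T → Fin n → Ω → Fin 2) (R : Fin T → Fin n → Ω → ℝ) (t : Fin T)
    (ω : Ω) : {s : Fin T // s < t} → Fin n → Fin 2 × ℝ :=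
  fun s i => (A s i ω, R s i ω)

/-- The sigma-algebra generated by the history prior to batch `t`. -/
abbrev histSigma (A : Fin T → Fin n → Ω → Fin 2) (R : Fin T → Fin n → Ω → ℝ) (t : Fin T) :
    MeasurableSpace Ω :=
  MeasurableSpace.comap (history A R t) inferInstance

/-- The vector of actions of batch `t`. -/
def actions (A : Fin T → Fin n → Ω → Fin 2) (t : Fin T) (ω : Ω) : Fin n → Fin 2 :=
  fun i => A t i ω

/-- `A`, `R` are the actions and rewards of a two-armed batched bandit with mean rewards `β`,
action selection probabilities `p t` (of arm `1`, in batch `t`) and standard normal errors: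
* given the history prior to batch `t`, the actions `A_{t,1}, …, A_{t,n}` are i.i.d.
  Bernoulli(`p t`);
* the errors of batch `t` are i.i.d. `N(0,1)`, independent of that history and of the actions of
  batch `t`. -/
structure IsGaussianBandit [MeasurableSpace Ω] (P : Measure Ω) (β : Fin 2 → ℝ)
    (p : Fin T → Ω → ℝ) (A : Fin T → Fin n → Ω → Fin 2) (R : Fin T → Fin n → Ω → ℝ) : Prop where
  measurable_action : ∀ t i, Measurable (A t i)
  measurable_reward : ∀ t i, Measurable (R t i)
  action_law : ∀ (t : Fin T) (a : Fin n → Fin 2),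
    P⟦{ω | actions A t ω = a} | histSigma A R t⟧
      =ᵐ[P] fun ω => ∏ i, if a i = 1 then p t ω else 1 - p t ω
  error_law : ∀ t, HasLaw (err β A R t) (Measure.pi fun _ : Fin n => gaussianReal 0 1) P
  error_indep : ∀ t, Indep (MeasurableSpace.comap (err β A R t) inferInstance)
    (histSigma A R t ⊔ MeasurableSpace.comap (actions A t) inferInstance) P

/-! ### Ordinary least squares -/

/-- The design matrix; its row `(t, i)` is `(1 - A_{t,i}, A_{t,i})`. -/
def design (A : Fin T → Fin n → Ω → Fin 2) (ω : Ω) : Matrix (Fin T × Fin n) (Fin 2) ℝ :=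
  Matrix.of fun k a => if A k.1 k.2 ω = a then 1 else 0

/-- The OLS estimator `(XᵀX)⁻¹ XᵀR`. -/
def olsEstimator (A : Fin T → Fin n → Ω → Fin 2) (R : Fin T → Fin n → Ω → ℝ) (ω : Ω) :
    Fin 2 → ℝ :=
  ((design A ω)ᵀ * design A ω)⁻¹ *ᵥ ((design A ω)ᵀ *ᵥ fun k => R k.1 k.2 ω)

/-- The total number of times arm `a` is selected. -/
def armCount (A : Fin T → Fin n → Ω → Fin 2) (a : Fin 2) (ω : Ω) : ℝ :=
  ∑ t, ∑ i, if A t i ω = a then 1 else 0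

/-- The Z-statistic of the OLS estimator of the margin `Δ = β 1 - β 0`, for noise variance `v`. -/
def zStat (v : ℝ) (β : Fin 2 → ℝ) (A : Fin T → Fin n → Ω → Fin 2) (R : Fin T → Fin n → Ω → ℝ)
    (ω : Ω) : ℝ :=
  √((armCount A 1 ω * armCount A 0 ω) / (T * v * n)) *
    ((olsEstimator A R ω 1 - olsEstimator A R ω 0) - (β 1 - β 0))

end Model

/-! ### Thompson Sampling -/

/-- The prior: the two arm means are independent `N(0,1)`. -/
def prior : Measure (Fin 2 → ℝ) := Measure.pi fun _ => gaussianReal 0 1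

/-- Likelihood of the arm means `b` given actions `a` and rewards `r`, for `N(0,1)` errors.
(The action selection probabilities do not depend on `b`, so they cancel in the posterior.) -/
def likelihood {n : ℕ} (a : Fin n → Fin 2) (r : Fin n → ℝ) (b : Fin 2 → ℝ) : ENNReal :=
  ∏ i, gaussianPDF (b (a i)) 1 (r i)

/-- The posterior distribution of the arm means given the data, by Bayes' formula. -/
def posteriorMeasure {n : ℕ} (a : Fin n → Fin 2) (r : Fin n → ℝ) : Measure (Fin 2 → ℝ) :=
  (∫⁻ b, likelihood a r b ∂prior)⁻¹ • prior.withDensity (likelihood a r)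

/-- Posterior probability that arm `1` is better than arm `0`. -/
def posteriorProb {n : ℕ} (a : Fin n → Fin 2) (r : Fin n → ℝ) : ℝ :=
  (posteriorMeasure a r).real {b | b 0 < b 1}

/-- Clipping to `[pmin, pmax]`. -/
def clip (pmin pmax x : ℝ) : ℝ := max pmin (min pmax x)

/-- Two-batch clipped Thompson Sampling: `1/2` in the first batch, and in the second batch the
clipped posterior probability, given the first batch, that arm `1` is better than arm `0`. -/
def thompsonProb {Ω : Type*} {n : ℕ} (pmin pmax : ℝ) (A : Fin 2 → Fin n → Ω → Fin 2)
    (R : Fin 2 → Fin n → Ω → ℝ) : Fin 2 → Ω → ℝ :=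
  ![fun _ => 1 / 2,
    fun ω => clip pmin pmax (posteriorProb (fun i => A 0 i ω) (fun i => R 0 i ω))]

/-! ### The limit distribution -/

/-- The law of four i.i.d. standard normals `Z_1, Z_2, Z_3, Z_4`, the coordinates
`z 0, z 1, z 2, z 3`. -/
abbrev stdNormal4 : Measure (Fin 4 → ℝ) := Measure.pi fun _ => gaussianReal 0 1

/-- `π_* = π_min ∨ (π_max ∧ Φ((Z_1 - Z_2)/√2))`, with `Φ` the standard normal distribution
function. -/
def piStar (pmin pmax : ℝ) (z : Fin 4 → ℝ) : ℝ :=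
  clip pmin pmax (cdf (gaussianReal 0 1) ((z 0 - z 1) / √2))

/-- The limit random variable, as a function of the four standard normals. -/
def limitVar (pmin pmax : ℝ) (z : Fin 4 → ℝ) : ℝ :=
  let q := piStar pmin pmax z
  √((1 / 2 + (1 - q)) / (2 * (1 / 2 + q))) * (√(1 / 2) * z 0 + √q * z 2)
    - √((1 / 2 + q) / (2 * (1 / 2 + (1 - q)))) * (√(1 / 2) * z 1 + √(1 - q) * z 3)

end BatchedBandit

end

namespace BatchedBandit

open scoped Topology

/-! The convergence part realises all batch sizes on one probability space. For fixed action
vectors, the error sums of the two arms in a batch are independent centred Gaussians whose variances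
are the arm counts. They can thus be replaced by square roots of counts times four standard normals
that do not depend on `n`. Integrating out errors and actions backwards in time
(`IsGaussianBandit.integral_data`, `sum_integral_armSums`) gives `integral_zStat`: the expectation
of `f` of the statistic is the integral of `condMean` over the four normals, and `condMean` averages
over Bernoulli action vectors only. By conjugacy (`posteriorProb_eq`) the second sampling
probability depends only on the counts and error sums of the first batch. With the normals fixed,
Chebyshev's inequality concentrates the selection frequencies at `1/2` and at `piStar`. At zero
margin the standardized posterior mean difference tends to `(z₀ - z₁) / √2`. Hence `condMean`
converges pointwise (`tendsto_condMean`), and dominated convergence concludes.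

For non-normality, put `X = (Z₁ - Z₂) / √2`. Given `X = x`, the limit is Gaussian with mean `s x`
and variance `1 - s ^ 2`, where `s = s(x)` is `slopeOf` of the clipped probability. Completing the
square gives `E exp(t Y) = exp(t ^ 2 / 2) * ∫ φ(x - t s(x)) dx`, with `φ` the standard normal
density (`lintegral_exp_limitVar`). If `Y` were Gaussian, the last integral would be `exp(m t + k t
^ 2)`. But `s` attains its maximum `S` on a whole half line, because of the clipping. Compared with
`∫ φ(x - t S) dx = 1`, on a right half line and for large `t`, the integral is strictly larger than
`1` and yet tends to `1`. Then `m t + k t ^ 2` is positive and tends to `0`, which is impossible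
(`lintegral_gaussianPDF_slope_ne`). A left half line is handled by reflection. -/

/-! ### The joint law of the data of a two-batch bandit -/

/-- Probability of the action vector `a` under i.i.d. Bernoulli(`p`) actions. -/
noncomputable def bernWeight {n : ℕ} (p : ℝ) (a : Fin n → Fin 2) : ℝ :=
  ∏ i, if a i = 1 then p else 1 - p

lemma measurable_bernWeight {n : ℕ} (a : Fin n → Fin 2) :
    Measurable fun p : ℝ => bernWeight p a := by
  unfold bernWeight
  refine Finset.measurable_prod _ fun i _ => ?_
  split_ifs <;> fun_prop

lemma bernWeight_nonneg {n : ℕ} {p : ℝ} (h0 : 0 ≤ p) (h1 : p ≤ 1) (a : Fin n → Fin 2) :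
    0 ≤ bernWeight p a := by
  refine Finset.prod_nonneg fun i _ => ?_
  split_ifs <;> linarith

lemma bernWeight_le_one {n : ℕ} {p : ℝ} (h0 : 0 ≤ p) (h1 : p ≤ 1) (a : Fin n → Fin 2) :
    bernWeight p a ≤ 1 := by
  refine Finset.prod_le_one (fun i _ => ?_) fun i _ => ?_ <;> split_ifs <;> linarith

lemma integral_eq_of_indepFun {Ω α γ : Type*} {mΩ : MeasurableSpace Ω} [MeasurableSpace α]
    [MeasurableSpace γ] {P : Measure Ω} [IsProbabilityMeasure P] {X : Ω → α} {Y : Ω → γ}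
    {ν : Measure γ} [IsProbabilityMeasure ν] (hX : Measurable X) (hXY : IndepFun X Y P)
    (hY : HasLaw Y ν P) {F : α × γ → ℝ} (hF : Measurable F) {C : ℝ} (hC : ∀ x, |F x| ≤ C) :
    ∫ ω, F (X ω, Y ω) ∂P = ∫ ω, ∫ y, F (X ω, y) ∂ν ∂P := by
  have h1 := (indepFun_iff_map_prod_eq_prod_map_map hX.aemeasurable hY.aemeasurable).1 hXY
  rw [hY.map_eq] at h1
  have : IsProbabilityMeasure (P.map X) := Measure.isProbabilityMeasure_map hX.aemeasurable
  have h2 : ∫ ω, F (X ω, Y ω) ∂P = ∫ z, F z ∂(P.map fun ω => (X ω, Y ω)) :=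
    (integral_map (hX.aemeasurable.prodMk hY.aemeasurable) hF.aestronglyMeasurable).symm
  have hint : Integrable F ((P.map X).prod ν) :=
    Integrable.of_bound hF.aestronglyMeasurable C (ae_of_all _ hC)
  rw [h2, h1, integral_prod _ hint, integral_map hX.aemeasurable]
  exact hF.stronglyMeasurable.integral_prod_right'.aestronglyMeasurable

lemma abs_integral_le_of_bound {α : Type*} [MeasurableSpace α] {ν : Measure α}
    [IsProbabilityMeasure ν] {f : α → ℝ} {C : ℝ} (h : ∀ x, |f x| ≤ C) : |∫ x, f x ∂ν| ≤ C := by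
  have h' : ∀ᵐ x ∂ν, ‖f x‖ ≤ C := ae_of_all _ h
  simpa using norm_integral_le_of_norm_le_const h'

section JointLaw

variable {Ω : Type*} {n : ℕ} {β : Fin 2 → ℝ}
  {A : Fin 2 → Fin n → Ω → Fin 2} {R : Fin 2 → Fin n → Ω → ℝ} {p : Fin 2 → Ω → ℝ}

lemma measurable_hist_actions : Measurable[histSigma A R 1] (actions A 0) := by
  have h1 : Measurable[histSigma A R 1] (history A R 1) := comap_measurable _
  refine @measurable_pi_lambda _ _ _ (histSigma A R 1) _ _ fun i => ?_
  have h2 := ((measurable_pi_apply i).comp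
    (measurable_pi_apply (⟨0, by decide⟩ : {s : Fin 2 // s < 1}))).comp h1
  exact measurable_fst.comp h2

lemma measurable_hist_err : Measurable[histSigma A R 1] (err β A R 0) := by
  have h1 : Measurable[histSigma A R 1] (history A R 1) := comap_measurable _
  refine @measurable_pi_lambda _ _ _ (histSigma A R 1) _ _ fun i => ?_
  have h2 := ((measurable_pi_apply i).comp
    (measurable_pi_apply (⟨0, by decide⟩ : {s : Fin 2 // s < 1}))).comp h1
  have h3 := (measurable_of_countable β).comp (measurable_fst.comp h2)
  exact (measurable_snd.comp h2).sub h3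

variable [mΩ : MeasurableSpace Ω] {P : Measure Ω}

/-- The law of the standard normal error vector of a batch of size `n`. -/
noncomputable abbrev errLaw (n : ℕ) : Measure (Fin n → ℝ) := Measure.pi fun _ => gaussianReal 0 1

namespace IsGaussianBandit

lemma measurable_actions (h : IsGaussianBandit P β p A R) (t : Fin 2) :
    Measurable (actions A t) := measurable_pi_lambda _ fun i => h.measurable_action t i

lemma measurable_err (h : IsGaussianBandit P β p A R) (t : Fin 2) :
    Measurable (err β A R t) := by
  refine measurable_pi_lambda _ fun i => ?_
  have := (measurable_of_countable β).comp (h.measurable_action t i)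
  exact (h.measurable_reward t i).sub this

lemma measurable_history (h : IsGaussianBandit P β p A R) (t : Fin 2) :
    Measurable (history A R t) :=
  measurable_pi_lambda _ fun s => measurable_pi_lambda _ fun i =>
    (h.measurable_action s i).prodMk (h.measurable_reward s i)

lemma histSigma_le (h : IsGaussianBandit P β p A R) (t : Fin 2) : histSigma A R t ≤ mΩ :=
  (h.measurable_history t).comap_le

variable [IsProbabilityMeasure P]

/-- Integrating out the actions of batch `t` given the history. -/
lemma integral_actions (h : IsGaussianBandit P β p A R) (t : Fin 2) (hp0 : ∀ ω, 0 ≤ p t ω)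
    (hp1 : ∀ ω, p t ω ≤ 1) (hp : Measurable (p t)) {G : Ω → (Fin n → Fin 2) → ℝ}
    (hG : ∀ a, Measurable[histSigma A R t] fun ω => G ω a) {C : ℝ} (hC : ∀ ω a, |G ω a| ≤ C) :
    ∫ ω, G ω (actions A t ω) ∂P = ∫ ω, ∑ a, bernWeight (p t ω) a * G ω a ∂P := by
  have hm := h.histSigma_le t
  have hS : ∀ a, MeasurableSet {ω | actions A t ω = a} := fun a =>
    h.measurable_actions t (measurableSet_singleton a)
  have hGi : ∀ a, Integrable (fun ω => G ω a) P := fun a =>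
    Integrable.of_bound ((hG a).mono hm le_rfl).aestronglyMeasurable C (ae_of_all _ fun ω => hC ω a)
  have h1 : ∀ ω, G ω (actions A t ω)
      = ∑ a, ((fun ω => G ω a) * Set.indicator {ω | actions A t ω = a} (fun _ => (1 : ℝ))) ω := by
    intro ω
    simp [Set.indicator_apply]
  have hii : ∀ a, Integrable
      ((fun ω => G ω a) * Set.indicator {ω | actions A t ω = a} (fun _ => (1 : ℝ))) P := by
    intro a
    have : ((fun ω => G ω a) * Set.indicator {ω | actions A t ω = a} (fun _ => (1 : ℝ)))
        = Set.indicator {ω | actions A t ω = a} (fun ω => G ω a) := by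
      ext ω; simp [Set.indicator_apply]
    rw [this]
    exact (hGi a).indicator (hS a)
  have hwi : ∀ a, Integrable (fun ω => bernWeight (p t ω) a * G ω a) P := fun a => by
    refine (hGi a).bdd_mul (c := 1)
      ((measurable_bernWeight a).comp hp).aestronglyMeasurable (ae_of_all _ fun ω => ?_)
    rw [Real.norm_eq_abs, abs_of_nonneg (bernWeight_nonneg (hp0 ω) (hp1 ω) a)]
    exact bernWeight_le_one (hp0 ω) (hp1 ω) a
  simp_rw [h1]
  rw [integral_finsetSum _ fun a _ => hii a, integral_finsetSum _ fun a _ => hwi a]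
  refine Finset.sum_congr rfl fun a _ => ?_
  -- Conditioning on the history lets the history-measurable factor `G · a` come out and turns the
  -- indicator of `a` into its Bernoulli weight.
  rw [← integral_condExp hm]
  refine integral_congr_ae ?_
  have h2 := condExp_mul_of_stronglyMeasurable_left (m := histSigma A R t)
    (hG a).stronglyMeasurable (hii a) ((integrable_const (1 : ℝ)).indicator (hS a))
  filter_upwards [h2, h.action_law t a] with ω hω hω'
  rw [hω, Pi.mul_apply, hω', mul_comm]
  rfl

/-- The expectation of a bounded function of all actions and errors. -/
lemma integral_data (h : IsGaussianBandit P β p A R)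
    {q : (Fin n → Fin 2) → (Fin n → ℝ) → ℝ} (hq : ∀ a, Measurable (q a))
    (hq0 : ∀ a e, 0 ≤ q a e) (hq1 : ∀ a e, q a e ≤ 1)
    (hp0 : p 0 = fun _ => 1 / 2) (hp1 : ∀ ω, p 1 ω = q (actions A 0 ω) (err β A R 0 ω))
    {F : (Fin n → Fin 2) → (Fin n → Fin 2) → (Fin n → ℝ) × (Fin n → ℝ) → ℝ}
    (hF : ∀ a a', Measurable (F a a')) {C : ℝ} (hC : ∀ a a' e, |F a a' e| ≤ C) :
    ∫ ω, F (actions A 0 ω) (actions A 1 ω) (err β A R 0 ω, err β A R 1 ω) ∂P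
      = ∑ a, bernWeight (1 / 2) a * ∫ e, ∑ a', bernWeight (q a e) a' *
          ∫ e', F a a' (e, e') ∂(errLaw n) ∂(errLaw n) := by
  have hqm : Measurable fun x : (Fin n → Fin 2) × (Fin n → ℝ) => q x.1 x.2 :=
    measurable_from_prod_countable_right fun a => hq a
  have hm0 := h.measurable_actions 0
  have hm1 := h.measurable_actions 1
  have he0 := h.measurable_err 0
  -- integrate out the errors of the second batch
  let X : Ω → ((Fin n → Fin 2) × (Fin n → Fin 2)) × (Fin n → ℝ) := fun ω =>
    ((actions A 0 ω, actions A 1 ω), err β A R 0 ω)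
  have hX : Measurable X := (hm0.prodMk hm1).prodMk he0
  have hXY : IndepFun X (err β A R 1) P := by
    rw [IndepFun_iff_Indep]
    refine indep_of_indep_of_le_left (h.error_indep 1).symm ?_
    rw [← measurable_iff_comap_le]
    have hA : Measurable[MeasurableSpace.comap (actions A 1) inferInstance] (actions A 1) :=
      comap_measurable _
    have h1 : Measurable[histSigma A R 1 ⊔ MeasurableSpace.comap (actions A 1) inferInstance]
        (actions A 0) := measurable_hist_actions.mono le_sup_left le_rfl
    have h2 : Measurable[histSigma A R 1 ⊔ MeasurableSpace.comap (actions A 1) inferInstance]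
        (actions A 1) := hA.mono le_sup_right le_rfl
    have h3 : Measurable[histSigma A R 1 ⊔ MeasurableSpace.comap (actions A 1) inferInstance]
        (err β A R 0) := measurable_hist_err.mono le_sup_left le_rfl
    exact (h1.prodMk h2).prodMk h3
  let F' : (((Fin n → Fin 2) × (Fin n → Fin 2)) × (Fin n → ℝ)) × (Fin n → ℝ) → ℝ := fun x =>
    F x.1.1.1 x.1.1.2 (x.1.2, x.2)
  have hF' : Measurable F' := by
    have : Measurable fun x : ((Fin n → Fin 2) × (Fin n → Fin 2)) × ((Fin n → ℝ) × (Fin n → ℝ)) =>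
        F x.1.1 x.1.2 x.2 := measurable_from_prod_countable_right fun a => hF a.1 a.2
    exact this.comp ((measurable_fst.comp measurable_fst).prodMk
      ((measurable_snd.comp measurable_fst).prodMk measurable_snd))
  have s1 := integral_eq_of_indepFun hX hXY (h.error_law 1) hF' (C := C) fun x => hC _ _ _
  -- integrate out the actions of the second batch
  let K : (Fin n → Fin 2) → (Fin n → Fin 2) → (Fin n → ℝ) → ℝ := fun a a' e =>
    ∫ e', F a a' (e, e') ∂(errLaw n)
  have hK : ∀ a a', Measurable (K a a') := fun a a' =>
    ((hF a a').stronglyMeasurable.integral_prod_right').measurable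
  have hKC : ∀ a a' e, |K a a' e| ≤ C := fun a a' e => abs_integral_le_of_bound fun e' => hC _ _ _
  have hKj : ∀ a', Measurable fun x : (Fin n → Fin 2) × (Fin n → ℝ) => K x.1 a' x.2 := fun a' =>
    measurable_from_prod_countable_right fun a => hK a a'
  have hp1' : p 1 = fun ω => q (actions A 0 ω) (err β A R 0 ω) := funext hp1
  have s2 := h.integral_actions 1 (fun ω => by rw [hp1]; exact hq0 _ _)
    (fun ω => by rw [hp1]; exact hq1 _ _) (by rw [hp1']; exact hqm.comp (hm0.prodMk he0))
    (G := fun ω a' => K (actions A 0 ω) a' (err β A R 0 ω))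
    (fun a' => (hKj a').comp
      (measurable_hist_actions.prodMk measurable_hist_err)) (C := C) fun ω a' => hKC _ _ _
  -- integrate out the errors of the first batch
  let L : (Fin n → Fin 2) × (Fin n → ℝ) → ℝ := fun x =>
    ∑ a', bernWeight (q x.1 x.2) a' * K x.1 a' x.2
  have hL : Measurable L :=
    Finset.measurable_sum _ fun a' _ => ((measurable_bernWeight a').comp hqm).mul (hKj a')
  have hLC : ∀ x, |L x| ≤ ∑ _a' : Fin n → Fin 2, C := fun x => by
    refine (Finset.abs_sum_le_sum_abs _ _).trans (Finset.sum_le_sum fun a' _ => ?_)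
    rw [abs_mul, abs_of_nonneg (bernWeight_nonneg (hq0 _ _) (hq1 _ _) a')]
    exact (mul_le_of_le_one_left (abs_nonneg _)
      (bernWeight_le_one (hq0 _ _) (hq1 _ _) a')).trans (hKC _ _ _)
  have hI0 : IndepFun (actions A 0) (err β A R 0) P := by
    rw [IndepFun_iff_Indep]
    exact indep_of_indep_of_le_left (h.error_indep 0).symm le_sup_right
  have s3 := integral_eq_of_indepFun hm0 hI0 (h.error_law 0) hL hLC
  -- integrate out the actions of the first batch
  have s4 := h.integral_actions 0 (fun ω => by rw [hp0]; norm_num)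
    (fun ω => by rw [hp0]; norm_num) (by rw [hp0]; exact measurable_const)
    (G := fun _ a => ∫ e, L (a, e) ∂(errLaw n)) (fun a => measurable_const)
    fun ω a => abs_integral_le_of_bound fun e => hLC _
  refine s1.trans (s2.trans ?_)
  refine (integral_congr_ae (ae_of_all _ fun ω => ?_)).trans (s3.trans (s4.trans ?_))
  · simp only [hp1, L]
  · simp [hp0, L, K]

end IsGaussianBandit

end JointLaw

/-! ### Gaussian sums over the two arms -/

/-- The number of selections of arm `b` in the action vector `a`. -/
noncomputable def selCount {n : ℕ} (a : Fin n → Fin 2) (b : Fin 2) : ℝ :=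
  ∑ i, if a i = b then 1 else 0

/-- The sum of the entries of `e` at the selections of arm `b`. -/
noncomputable def armSum {n : ℕ} (a : Fin n → Fin 2) (e : Fin n → ℝ) (b : Fin 2) : ℝ :=
  ∑ i, if a i = b then e i else 0

lemma selCount_nonneg {n : ℕ} (a : Fin n → Fin 2) (b : Fin 2) : 0 ≤ selCount a b :=
  Finset.sum_nonneg fun i _ => by split_ifs <;> norm_num

lemma selCount_zero {n : ℕ} (a : Fin n → Fin 2) : selCount a 0 = n - selCount a 1 := by
  have h : selCount a 0 + selCount a 1 = n := by
    unfold selCount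
    rw [← Finset.sum_add_distrib, Finset.sum_congr rfl (g := fun _ => (1 : ℝ))]
    · simp
    · intro i _
      generalize a i = x
      fin_cases x <;> simp
  linarith

lemma selCount_le {n : ℕ} (a : Fin n → Fin 2) (b : Fin 2) : selCount a b ≤ n := by
  have h0 := selCount_zero a
  have h1 := selCount_nonneg a 0
  have h2 := selCount_nonneg a 1
  fin_cases b <;> simp only [Fin.zero_eta, Fin.mk_one] <;> linarith

lemma map_sum_pi_gaussianReal {n : ℕ} (S : Finset (Fin n)) :
    (Measure.pi fun _ : Fin n => gaussianReal 0 1).map (fun e => ∑ i ∈ S, e i)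
      = gaussianReal 0 (S.card : NNReal) := by
  have hi : iIndepFun (fun (i : Fin n) (e : Fin n → ℝ) => e i)
      (Measure.pi fun _ : Fin n => gaussianReal 0 1) :=
    iIndepFun_pi (X := fun _ x => x) fun i => aemeasurable_id
  induction S using Finset.induction_on with
  | empty => simp
  | insert i S hiS ih =>
    have h1 := hi.indepFun_finsetSum_of_notMem (fun i => measurable_pi_apply i) hiS
    have h2 := gaussianReal_add_gaussianReal_of_indepFun h1
      (by convert! ih using 2; ext e; simp)
      (measurePreserving_eval (fun _ : Fin n => gaussianReal 0 1) i).map_eq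
    rw [add_zero] at h2
    rw [Finset.card_insert_of_notMem hiS]
    push_cast
    rw [← h2]
    congr 1
    ext e
    simp [Finset.sum_insert hiS, add_comm]

/-- The two arms are selected on disjoint index sets, so their error sums are independent, with
variances equal to the counts. A count of zero is covered by the factor `√0`. -/
lemma map_armSum {n : ℕ} (a : Fin n → Fin 2) :
    (Measure.pi fun _ : Fin n => gaussianReal 0 1).map (fun e => (armSum a e 1, armSum a e 0))
      = ((gaussianReal 0 1).prod (gaussianReal 0 1)).map
          (fun x => (√(selCount a 1) * x.1, √(selCount a 0) * x.2)) := by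
  have hi : iIndepFun (fun (i : Fin n) (e : Fin n → ℝ) => e i)
      (Measure.pi fun _ : Fin n => gaussianReal 0 1) :=
    iIndepFun_pi (X := fun _ x => x) fun i => aemeasurable_id
  have hs : ∀ (b : Fin 2) (e : Fin n → ℝ),
      armSum a e b = ∑ i ∈ Finset.univ.filter (fun i => a i = b), e i := fun b e => by
    rw [Finset.sum_filter, armSum]
  have hm : ∀ b, Measurable fun e => armSum a e b := fun b => by
    simp_rw [hs]; fun_prop
  have hlaw : ∀ b, (Measure.pi fun _ : Fin n => gaussianReal 0 1).map (fun e => armSum a e b)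
      = (gaussianReal 0 1).map (fun x => √(selCount a b) * x) := fun b => by
    simp_rw [hs]
    rw [map_sum_pi_gaussianReal, gaussianReal_map_const_mul]
    congr 1
    · simp
    · ext
      have := selCount_nonneg a b
      simp [selCount]
  have hd : Disjoint (Finset.univ.filter (fun i => a i = 1))
      (Finset.univ.filter (fun i => a i = 0)) := by
    rw [Finset.disjoint_filter]
    intro i _ h1 h0
    simp [h1] at h0
  have hind : IndepFun (fun e => armSum a e 1) (fun e => armSum a e 0)
      (Measure.pi fun _ : Fin n => gaussianReal 0 1) := by
    have h1 := (hi.indepFun_finset _ _ hd fun i => measurable_pi_apply i).comp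
      (φ := fun x => ∑ i, x i) (ψ := fun x => ∑ i, x i) (by fun_prop) (by fun_prop)
    convert! h1 using 1 <;> ext e <;> simp only [hs, Function.comp_apply] <;>
      exact (Finset.sum_coe_sort _ e).symm
  rw [(indepFun_iff_map_prod_eq_prod_map_map (hm 1).aemeasurable (hm 0).aemeasurable).1 hind,
    hlaw, hlaw, Measure.map_prod_map _ _ (by fun_prop) (by fun_prop)]
  rfl

lemma measurable_armSum {n : ℕ} (a : Fin n → Fin 2) (b : Fin 2) :
    Measurable fun e => armSum a e b := by
  unfold armSum
  refine Finset.measurable_sum _ fun i _ => ?_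
  split_ifs <;> fun_prop

lemma integral_armSum {n : ℕ} (a : Fin n → Fin 2) {g : ℝ × ℝ → ℝ} (hg : Measurable g) :
    ∫ e, g (armSum a e 1, armSum a e 0) ∂(Measure.pi fun _ : Fin n => gaussianReal 0 1)
      = ∫ x, g (√(selCount a 1) * x.1, √(selCount a 0) * x.2)
          ∂((gaussianReal 0 1).prod (gaussianReal 0 1)) := by
  have h1 := integral_map (μ := Measure.pi fun _ : Fin n => gaussianReal 0 1)
    (φ := fun e => (armSum a e 1, armSum a e 0))
    ((measurable_armSum a 1).prodMk (measurable_armSum a 0)).aemeasurable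
    (f := g) hg.aestronglyMeasurable
  rw [← h1, map_armSum, integral_map (by fun_prop) hg.aestronglyMeasurable]

lemma map_stdNormal4 :
    stdNormal4 = (((gaussianReal 0 1).prod (gaussianReal 0 1)).prod
      ((gaussianReal 0 1).prod (gaussianReal 0 1))).map
        fun x => ![x.1.1, x.1.2, x.2.1, x.2.2] := by
  refine Measure.pi_eq fun s hs => ?_
  have hm : Measurable fun x : (ℝ × ℝ) × (ℝ × ℝ) => ![x.1.1, x.1.2, x.2.1, x.2.2] := by
    refine measurable_pi_lambda _ fun i => ?_
    fin_cases i <;> simp <;> fun_prop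
  rw [Measure.map_apply hm (MeasurableSet.univ_pi hs)]
  have : (fun x : (ℝ × ℝ) × (ℝ × ℝ) => ![x.1.1, x.1.2, x.2.1, x.2.2]) ⁻¹' (Set.univ.pi s)
      = (s 0 ×ˢ s 1) ×ˢ (s 2 ×ˢ s 3) := by
    ext x
    simp [Set.mem_pi, Fin.forall_fin_succ, and_assoc]
  rw [this, Measure.prod_prod, Measure.prod_prod, Measure.prod_prod, Fin.prod_univ_four]
  ring

/-! ### The posterior probability that arm `1` is better -/

lemma gaussianPDFReal_one (m x : ℝ) :
    gaussianPDFReal m 1 x = (√(2 * Real.pi))⁻¹ * Real.exp (-(x - m) ^ 2 / 2) := by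
  simp [gaussianPDFReal]

lemma cdf_gaussianReal_div_sqrt {v : NNReal} (hv : v ≠ 0) (m : ℝ) :
    (gaussianReal m v).real (Set.Iio 0) = cdf (gaussianReal 0 1) (-m / √v) := by
  have hv' : 0 < √(v : ℝ) := Real.sqrt_pos.2 (by positivity)
  have h1 : gaussianReal m v = (gaussianReal 0 1).map (fun x => √v * x + m) := by
    have : (fun x => √v * x + m) = (fun x => x + m) ∘ (fun x => √v * x) := rfl
    rw [this, ← Measure.map_map (by fun_prop) (by fun_prop), gaussianReal_map_const_mul,
      gaussianReal_map_add_const]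
    congr 1
    · simp
    · ext; simp
  have := nullSingletonClass_gaussianReal (μ := 0) (v := 1) one_ne_zero
  rw [cdf_eq_real, h1, map_measureReal_apply (by fun_prop) measurableSet_Iio]
  have h2 : (fun x => √v * x + m) ⁻¹' Set.Iio 0 = Set.Iio (-m / √v) := by
    ext x
    simp only [Set.mem_preimage, Set.mem_Iio]
    rw [lt_div_iff₀ hv']
    constructor <;> intro h <;> linarith
  rw [h2]
  exact measureReal_congr Iio_ae_eq_Iic

lemma prod_gaussianReal_lt {m₀ m₁ : ℝ} {v₀ v₁ : NNReal} (hv : v₀ + v₁ ≠ 0) :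
    ((gaussianReal m₀ v₀).prod (gaussianReal m₁ v₁)).real {x | x.1 < x.2}
      = cdf (gaussianReal 0 1) ((m₁ - m₀) / √(v₀ + v₁)) := by
  have h1 : ((gaussianReal m₀ v₀).prod (gaussianReal m₁ v₁)).map (fun x => x.1 - x.2)
      = gaussianReal (m₀ - m₁) (v₀ + v₁) := by
    rw [sub_eq_add_neg, ← gaussianReal_conv_gaussianReal, ← gaussianReal_map_neg, Measure.conv]
    have h2 : (fun x : ℝ × ℝ => x.1 - x.2) = (fun x => x.1 + x.2) ∘ (Prod.map id fun x => -x) := by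
      ext x; simp [sub_eq_add_neg]
    rw [h2, ← Measure.map_map (by fun_prop) (by fun_prop),
      ← Measure.map_prod_map _ _ (by fun_prop) (by fun_prop), Measure.map_id]
  have h2 := cdf_gaussianReal_div_sqrt hv (m₀ - m₁)
  rw [← h1, map_measureReal_apply (by fun_prop) measurableSet_Iio] at h2
  rw [neg_sub, NNReal.coe_add] at h2
  rw [← h2]
  congr 1
  ext x
  simp

/-- The posterior mean of arm `b`. -/
noncomputable def postMean {n : ℕ} (a : Fin n → Fin 2) (r : Fin n → ℝ) (b : Fin 2) : ℝ :=
  armSum a r b / (selCount a b + 1)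

/-- The posterior variance of arm `b`. -/
noncomputable def postVar {n : ℕ} (a : Fin n → Fin 2) (b : Fin 2) : NNReal :=
  ⟨1 / (selCount a b + 1), by have := selCount_nonneg a b; positivity⟩

lemma postVar_ne_zero {n : ℕ} (a : Fin n → Fin 2) (b : Fin 2) : postVar a b ≠ 0 := by
  have h := selCount_nonneg a b
  rw [← NNReal.coe_ne_zero]
  show 1 / (selCount a b + 1) ≠ 0
  positivity

lemma sum_sq_sub_eq {n : ℕ} (a : Fin n → Fin 2) (r : Fin n → ℝ) (b : Fin 2 → ℝ) :
    ∑ i, (r i - b (a i)) ^ 2 = ∑ i, r i ^ 2 - 2 * (b 0 * armSum a r 0 + b 1 * armSum a r 1)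
      + (b 0 ^ 2 * selCount a 0 + b 1 ^ 2 * selCount a 1) := by
  simp only [armSum, selCount, Finset.mul_sum, ← Finset.sum_add_distrib, ← Finset.sum_sub_distrib]
  refine Finset.sum_congr rfl fun i _ => ?_
  generalize a i = x
  fin_cases x <;> simp <;> ring

lemma prod_gaussianPDFReal {n : ℕ} (a : Fin n → Fin 2) (r : Fin n → ℝ) (b : Fin 2 → ℝ) :
    ∏ i, gaussianPDFReal (b (a i)) 1 (r i)
      = (√(2 * Real.pi))⁻¹ ^ n * Real.exp (-(∑ i, (r i - b (a i)) ^ 2) / 2) := by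
  simp only [gaussianPDFReal_one]
  rw [Finset.prod_mul_distrib, ← Real.exp_sum]
  simp [← Finset.sum_div, ← Finset.sum_neg_distrib]

lemma gaussianPDFReal_postMean {n : ℕ} (a : Fin n → Fin 2) (r : Fin n → ℝ) (b : Fin 2) (x : ℝ) :
    gaussianPDFReal (postMean a r b) (postVar a b) x = (√(2 * Real.pi * postVar a b))⁻¹ *
      Real.exp (-((selCount a b + 1) * x ^ 2) / 2 + armSum a r b * x
        - armSum a r b ^ 2 / (2 * (selCount a b + 1))) := by
  have h := selCount_nonneg a b
  have h' : selCount a b + 1 ≠ 0 := by positivity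
  rw [gaussianPDFReal]
  congr 2
  have : (postVar a b : ℝ) = 1 / (selCount a b + 1) := rfl
  rw [this, postMean]
  field_simp
  ring

/-- Normal conjugacy: completing the square in each arm mean separately. `K` collects what does not
depend on `b`, namely the normalising constants and the exponents left over from the squares. -/
lemma likelihood_mul_prior {n : ℕ} (a : Fin n → Fin 2) (r : Fin n → ℝ) :
    ∃ K : ENNReal, K ≠ 0 ∧ K ≠ ⊤ ∧ ∀ b : Fin 2 → ℝ,
      gaussianPDF 0 1 (b 0) * gaussianPDF 0 1 (b 1) * likelihood a r b
        = K * (gaussianPDF (postMean a r 0) (postVar a 0) (b 0)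
          * gaussianPDF (postMean a r 1) (postVar a 1) (b 1)) := by
  have hv : ∀ b, 0 < √(2 * Real.pi * postVar a b) := fun b => by
    have h := pos_iff_ne_zero.2 (postVar_ne_zero a b)
    positivity
  have hv0 := hv 0
  have hv1 := hv 1
  let K : ℝ := (√(2 * Real.pi))⁻¹ * (√(2 * Real.pi))⁻¹ * (√(2 * Real.pi))⁻¹ ^ n *
    √(2 * Real.pi * postVar a 0) * √(2 * Real.pi * postVar a 1) *
    Real.exp (armSum a r 0 ^ 2 / (2 * (selCount a 0 + 1))
      + armSum a r 1 ^ 2 / (2 * (selCount a 1 + 1)) - (∑ i, r i ^ 2) / 2)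
  have hK : 0 < K := by positivity
  refine ⟨ENNReal.ofReal K, by simpa using hK, ENNReal.ofReal_ne_top, fun b => ?_⟩
  have h1 : likelihood a r b = ENNReal.ofReal (∏ i, gaussianPDFReal (b (a i)) 1 (r i)) := by
    rw [ENNReal.ofReal_prod_of_nonneg fun i _ => gaussianPDFReal_nonneg _ _ _]
    rfl
  simp only [gaussianPDF]
  rw [h1, ← ENNReal.ofReal_mul (gaussianPDFReal_nonneg _ _ _),
    ← ENNReal.ofReal_mul (mul_nonneg (gaussianPDFReal_nonneg _ _ _) (gaussianPDFReal_nonneg _ _ _)),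
    ← ENNReal.ofReal_mul (gaussianPDFReal_nonneg _ _ _), ← ENNReal.ofReal_mul hK.le]
  congr 1
  rw [prod_gaussianPDFReal, gaussianPDFReal_postMean, gaussianPDFReal_postMean,
    gaussianPDFReal_one, gaussianPDFReal_one, sum_sq_sub_eq]
  have e1 : ∀ c d x y z : ℝ, (c * Real.exp x) * (c * Real.exp y) * (d * Real.exp z)
      = c * c * d * Real.exp (x + y + z) := fun c d x y z => by
    rw [Real.exp_add, Real.exp_add]; ring
  have e2 : ∀ c d s t x y z : ℝ, s ≠ 0 → t ≠ 0 →
      c * c * d * s * t * Real.exp x * (s⁻¹ * Real.exp y * (t⁻¹ * Real.exp z))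
      = c * c * d * Real.exp (x + y + z) := fun c d s t x y z hs ht => by
    rw [Real.exp_add, Real.exp_add]; field_simp
  rw [e1, e2 _ _ _ _ _ _ _ hv0.ne' hv1.ne']
  congr 2
  ring

lemma measurable_likelihood {n : ℕ} (a : Fin n → Fin 2) (r : Fin n → ℝ) :
    Measurable (likelihood a r) := by
  unfold likelihood
  refine Finset.measurable_prod _ fun i _ => ?_
  have h : Measurable fun b : Fin 2 → ℝ => (b (a i), (1 : NNReal), r i) :=
    (measurable_pi_apply (a i)).prodMk measurable_const
  exact measurable_uncurry_gaussianPDF.comp h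

lemma gaussianReal_prod_eq_withDensity (m₀ m₁ : ℝ) {v₀ v₁ : NNReal} (h₀ : v₀ ≠ 0) (h₁ : v₁ ≠ 0) :
    (gaussianReal m₀ v₀).prod (gaussianReal m₁ v₁) = ((volume : Measure ℝ).prod volume).withDensity
      fun x => gaussianPDF m₀ v₀ x.1 * gaussianPDF m₁ v₁ x.2 := by
  rw [gaussianReal_of_var_ne_zero _ h₀, gaussianReal_of_var_ne_zero _ h₁,
    prod_withDensity (measurable_gaussianPDF _ _) (measurable_gaussianPDF _ _)]

/-- The constant is the same for every `s`; with `s = univ` it is the normaliser in Bayes' formula,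
so it cancels in the posterior. -/
lemma setLIntegral_likelihood {n : ℕ} (a : Fin n → Fin 2) (r : Fin n → ℝ) :
    ∃ K : ENNReal, K ≠ 0 ∧ K ≠ ⊤ ∧ ∀ s : Set (ℝ × ℝ), MeasurableSet s →
      ∫⁻ b in {b : Fin 2 → ℝ | (b 0, b 1) ∈ s}, likelihood a r b ∂prior
        = K * ((gaussianReal (postMean a r 0) (postVar a 0)).prod
            (gaussianReal (postMean a r 1) (postVar a 1))) s := by
  obtain ⟨K, hK0, hKt, hK⟩ := likelihood_mul_prior a r
  refine ⟨K, hK0, hKt, fun s hs => ?_⟩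
  have hmp := measurePreserving_finTwoArrow (gaussianReal 0 1)
  have h1 : ∫⁻ b in {b : Fin 2 → ℝ | (b 0, b 1) ∈ s}, likelihood a r b ∂prior
      = ∫⁻ x in s, likelihood a r ![x.1, x.2] ∂((gaussianReal 0 1).prod (gaussianReal 0 1)) := by
    rw [← hmp.setLIntegral_comp_preimage_emb (MeasurableEquiv.measurableEmbedding _)]
    refine setLIntegral_congr_fun ?_ fun b _ => ?_
    · exact hmp.measurable hs
    · congr 1
      ext i
      fin_cases i <;> rfl
  have hml : Measurable fun x : ℝ × ℝ => likelihood a r ![x.1, x.2] := by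
    refine (measurable_likelihood a r).comp (measurable_pi_lambda _ fun i => ?_)
    fin_cases i <;> simp <;> fun_prop
  have hmp : ∀ m₀ m₁ v₀ v₁, Measurable fun x : ℝ × ℝ =>
      gaussianPDF m₀ v₀ x.1 * gaussianPDF m₁ v₁ x.2 := fun m₀ m₁ v₀ v₁ =>
    ((measurable_gaussianPDF _ _).comp measurable_fst).mul
      ((measurable_gaussianPDF _ _).comp measurable_snd)
  rw [h1, gaussianReal_prod_eq_withDensity _ _ one_ne_zero one_ne_zero,
    gaussianReal_prod_eq_withDensity _ _ (postVar_ne_zero a 0) (postVar_ne_zero a 1),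
    withDensity_apply _ hs, setLIntegral_withDensity_eq_setLIntegral_mul _ (hmp _ _ _ _) hml hs,
    ← lintegral_const_mul _ (hmp _ _ _ _)]
  refine setLIntegral_congr_fun hs fun x _ => ?_
  simpa using hK ![x.1, x.2]

lemma posteriorProb_eq {n : ℕ} (a : Fin n → Fin 2) (r : Fin n → ℝ) :
    posteriorProb a r = cdf (gaussianReal 0 1)
      ((armSum a r 1 / (selCount a 1 + 1) - armSum a r 0 / (selCount a 0 + 1)) /
        √(1 / (selCount a 0 + 1) + 1 / (selCount a 1 + 1))) := by
  obtain ⟨K, hK0, hKt, hK⟩ := setLIntegral_likelihood a r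
  have hs : MeasurableSet {b : Fin 2 → ℝ | b 0 < b 1} :=
    measurableSet_lt (measurable_pi_apply 0) (measurable_pi_apply 1)
  have h1 := hK Set.univ MeasurableSet.univ
  have h2 := hK {x | x.1 < x.2} (measurableSet_lt measurable_fst measurable_snd)
  simp only [Set.mem_univ, Set.ofPred_true, Measure.restrict_univ, measure_univ, mul_one] at h1
  simp only [Set.mem_ofPred_eq] at h2
  rw [posteriorProb, posteriorMeasure, measureReal_def, Measure.smul_apply,
    withDensity_apply _ hs, h1, h2, smul_eq_mul, ← mul_assoc, ENNReal.inv_mul_cancel hK0 hKt,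
    one_mul, ← measureReal_def, prod_gaussianReal_lt]
  · rfl
  · simp [postVar_ne_zero]

/-! ### The Z-statistic as a function of arm counts and error sums -/

/-- The Z-statistic in terms of the total counts `c₁`, `c₀` and total error sums `E₁`, `E₀`. -/
noncomputable def zForm (n : ℕ) (c₁ c₀ E₁ E₀ : ℝ) : ℝ :=
  √(c₁ * c₀ / (2 * n)) * (E₁ / c₁ - E₀ / c₀)

section Statistic

variable {Ω : Type*} {n : ℕ}

lemma design_transpose_mul_design (A : Fin 2 → Fin n → Ω → Fin 2) (ω : Ω) :
    (design A ω)ᵀ * design A ω = Matrix.diagonal fun b => armCount A b ω := by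
  ext b c
  simp only [Matrix.mul_apply, Matrix.transpose_apply, design, Matrix.of_apply,
    Fintype.sum_prod_type, Matrix.diagonal_apply, armCount]
  split_ifs with h
  · subst h
    simp only [mul_ite, mul_one, mul_zero]
    refine Finset.sum_congr rfl fun t _ => Finset.sum_congr rfl fun i _ => ?_
    split_ifs <;> rfl
  · refine Finset.sum_eq_zero fun t _ => Finset.sum_eq_zero fun i _ => ?_
    by_cases hb : A t i ω = b
    · simp [hb, h]
    · simp [hb]

lemma armSum_actions (A : Fin 2 → Fin n → Ω → Fin 2) (t b : Fin 2) (ω : Ω) (e : Fin n → ℝ) :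
    armSum (actions A t ω) e b = ∑ i, if A t i ω = b then e i else 0 := rfl

lemma selCount_actions (A : Fin 2 → Fin n → Ω → Fin 2) (t b : Fin 2) (ω : Ω) :
    selCount (actions A t ω) b = ∑ i, if A t i ω = b then 1 else 0 := rfl

lemma armCount_eq (A : Fin 2 → Fin n → Ω → Fin 2) (b : Fin 2) (ω : Ω) :
    armCount A b ω = selCount (actions A 0 ω) b + selCount (actions A 1 ω) b := by
  simp only [armCount, Fin.sum_univ_two, selCount_actions]

lemma reward_sum_eq (β : Fin 2 → ℝ) (A : Fin 2 → Fin n → Ω → Fin 2) (R : Fin 2 → Fin n → Ω → ℝ)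
    (t b : Fin 2) (ω : Ω) :
    armSum (actions A t ω) (fun i => R t i ω) b
      = armSum (actions A t ω) (err β A R t ω) b + β b * selCount (actions A t ω) b := by
  simp only [armSum_actions, selCount_actions, Finset.mul_sum, ← Finset.sum_add_distrib, err]
  refine Finset.sum_congr rfl fun i _ => ?_
  split_ifs with h
  · rw [h]; ring
  · simp

/-- The columns of the design matrix are indicators of disjoint sets, so the Gram matrix is diagonal
and least squares returns the sample mean of each arm. -/
lemma olsEstimator_eq (β : Fin 2 → ℝ) (A : Fin 2 → Fin n → Ω → Fin 2) (R : Fin 2 → Fin n → Ω → ℝ)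
    (ω : Ω) (h : ∀ b, armCount A b ω ≠ 0) (b : Fin 2) :
    olsEstimator A R ω b = β b + (armSum (actions A 0 ω) (err β A R 0 ω) b
      + armSum (actions A 1 ω) (err β A R 1 ω) b) / armCount A b ω := by
  have h1 : ((design A ω)ᵀ *ᵥ fun k => R k.1 k.2 ω) b
      = armSum (actions A 0 ω) (fun i => R 0 i ω) b
        + armSum (actions A 1 ω) (fun i => R 1 i ω) b := by
    simp [Matrix.mulVec, dotProduct, design, Fintype.sum_prod_type, armSum_actions,
      Fin.sum_univ_two]
  have hu : IsUnit (fun b => armCount A b ω) := by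
    rw [Pi.isUnit_iff]
    exact fun b => (h b).isUnit
  rw [olsEstimator, design_transpose_mul_design, Matrix.inv_diagonal, Matrix.mulVec_diagonal, h1,
    Ring.inverse_of_isUnit hu]
  rw [reward_sum_eq β, reward_sum_eq β]
  have h2 : ((hu.unit⁻¹ : (Fin 2 → ℝ)ˣ) : Fin 2 → ℝ) b = (armCount A b ω)⁻¹ := by
    refine eq_inv_of_mul_eq_one_left ?_
    have := congrFun (hu.val_inv_mul) b
    simpa using this
  rw [h2]
  have h3 := armCount_eq A b ω
  have h4 := h b
  field_simp
  rw [h3]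
  ring

lemma zStat_eq (β : Fin 2 → ℝ) (A : Fin 2 → Fin n → Ω → Fin 2) (R : Fin 2 → Fin n → Ω → ℝ)
    (ω : Ω) : zStat 1 β A R ω
      = zForm n (selCount (actions A 0 ω) 1 + selCount (actions A 1 ω) 1)
          (selCount (actions A 0 ω) 0 + selCount (actions A 1 ω) 0)
          (armSum (actions A 0 ω) (err β A R 0 ω) 1 + armSum (actions A 1 ω) (err β A R 1 ω) 1)
          (armSum (actions A 0 ω) (err β A R 0 ω) 0 + armSum (actions A 1 ω) (err β A R 1 ω) 0) := by
  rw [zStat, zForm, ← armCount_eq, ← armCount_eq]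
  by_cases h : ∀ b, armCount A b ω ≠ 0
  · rw [olsEstimator_eq β A R ω h, olsEstimator_eq β A R ω h]
    push_cast
    ring_nf
  -- If an arm is never selected, the square root factor vanishes on both sides, whatever value the
  -- singular inverse takes.
  · have : armCount A 1 ω * armCount A 0 ω = 0 := by
      push Not at h
      obtain ⟨b, hb⟩ := h
      fin_cases b
      · exact mul_eq_zero_of_right _ hb
      · exact mul_eq_zero_of_left hb _
    simp [this]

end Statistic

lemma measurable_zForm (n : ℕ) (c₁ c₀ : ℝ) :
    Measurable fun x : ℝ × ℝ => zForm n c₁ c₀ x.1 x.2 := by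
  unfold zForm
  fun_prop

/-! ### Concentration of the arm counts -/

lemma sum_prod_apply {n : ℕ} (g : Fin n → Fin 2 → ℝ) :
    ∑ a : Fin n → Fin 2, ∏ i, g i (a i) = ∏ i, (g i 0 + g i 1) := by
  rw [← Fintype.piFinset_univ, ← Finset.prod_univ_sum]
  simp [Fin.sum_univ_two]

lemma sum_bernWeight {n : ℕ} (p : ℝ) : ∑ a : Fin n → Fin 2, bernWeight p a = 1 := by
  unfold bernWeight
  rw [sum_prod_apply fun _ b => if b = 1 then p else 1 - p]
  simp

/-- Independence in finite form: the summand is a product over coordinates, so the sum factors. For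
`i ≠ j` the factor at `i` is the mean of a centred indicator, which is zero. -/
lemma sum_bernWeight_mul_mul {n : ℕ} (p : ℝ) (i j : Fin n) :
    ∑ a : Fin n → Fin 2, bernWeight p a *
      (((if a i = 1 then 1 else 0) - p) * ((if a j = 1 then 1 else 0) - p))
      = if i = j then p * (1 - p) else 0 := by
  let g : Fin n → Fin 2 → ℝ := fun l b => (if b = 1 then p else 1 - p) *
    ((if l = i then (if b = 1 then 1 else 0) - p else 1) *
      (if l = j then (if b = 1 then 1 else 0) - p else 1))
  have h1 : ∀ a : Fin n → Fin 2, bernWeight p a *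
      (((if a i = 1 then 1 else 0) - p) * ((if a j = 1 then 1 else 0) - p))
      = ∏ l, g l (a l) := by
    intro a
    simp only [g, Finset.prod_mul_distrib, bernWeight, Finset.prod_ite_eq', Finset.mem_univ,
      if_true]
  simp_rw [h1]
  rw [sum_prod_apply]
  split_ifs with h
  · subst h
    rw [Finset.prod_eq_single i]
    · simp [g]; ring
    · intro l _ hl
      simp [g, hl]
    · simp
  · refine Finset.prod_eq_zero (Finset.mem_univ i) ?_
    simp [g, h]
    ring

lemma sum_bernWeight_mul_sq {n : ℕ} (p : ℝ) :
    ∑ a : Fin n → Fin 2, bernWeight p a * (selCount a 1 - n * p) ^ 2 = n * (p * (1 - p)) := by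
  have h1 : ∀ a : Fin n → Fin 2, bernWeight p a * (selCount a 1 - n * p) ^ 2
      = ∑ i, ∑ j, bernWeight p a *
      (((if a i = 1 then 1 else 0) - p) * ((if a j = 1 then 1 else 0) - p)) := by
    intro a
    have : selCount a 1 - n * p = ∑ i, ((if a i = 1 then 1 else 0) - p) := by
      simp [selCount, Finset.sum_sub_distrib]
    rw [this, sq, Finset.sum_mul_sum, Finset.mul_sum]
    simp_rw [Finset.mul_sum]
  simp_rw [h1]
  rw [Finset.sum_comm]
  simp_rw [Finset.sum_comm (s := (Finset.univ : Finset (Fin n → Fin 2)))]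
  simp_rw [sum_bernWeight_mul_mul]
  simp

/-- Chebyshev's inequality: `|g x - L|` is at most `η + C * (x - p) ^ 2 / δ ^ 2` everywhere, and the
selection frequency has variance `p * (1 - p) / n ≤ 1 / n`. -/
lemma abs_sum_bernWeight_sub_le {n : ℕ} (hn : n ≠ 0) {p : ℝ} (hp0 : 0 ≤ p) (hp1 : p ≤ 1)
    {g : ℝ → ℝ} {L C η δ : ℝ} (hδ : 0 < δ) (hη : 0 ≤ η) (hC : ∀ x, |g x - L| ≤ C)
    (hg : ∀ x, |x - p| < δ → |g x - L| ≤ η) :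
    |∑ a : Fin n → Fin 2, bernWeight p a * g (selCount a 1 / n) - L| ≤ η + C / (n * δ ^ 2) := by
  have hn' : (0 : ℝ) < n := by positivity
  have hC0 : 0 ≤ C := (abs_nonneg _).trans (hC 0)
  have h1 : ∑ a : Fin n → Fin 2, bernWeight p a * g (selCount a 1 / n) - L
      = ∑ a : Fin n → Fin 2, bernWeight p a * (g (selCount a 1 / n) - L) := by
    simp_rw [mul_sub, Finset.sum_sub_distrib, ← Finset.sum_mul, sum_bernWeight, one_mul]
  have h2 : ∀ x, |g x - L| ≤ η + C * (x - p) ^ 2 / δ ^ 2 := by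
    intro x
    rcases lt_or_ge |x - p| δ with h | h
    · have : 0 ≤ C * (x - p) ^ 2 / δ ^ 2 := by positivity
      linarith [hg x h]
    · have h3 : δ ^ 2 ≤ (x - p) ^ 2 := by
        rw [← sq_abs (x - p)]
        gcongr
      have h4 : C ≤ C * (x - p) ^ 2 / δ ^ 2 := by
        rw [le_div_iff₀ (by positivity)]
        gcongr
      linarith [hC x]
  rw [h1]
  calc |∑ a : Fin n → Fin 2, bernWeight p a * (g (selCount a 1 / n) - L)|
      ≤ ∑ a : Fin n → Fin 2, bernWeight p a * (η + C * (selCount a 1 / n - p) ^ 2 / δ ^ 2) := by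
        refine (Finset.abs_sum_le_sum_abs _ _).trans (Finset.sum_le_sum fun a _ => ?_)
        rw [abs_mul, abs_of_nonneg (bernWeight_nonneg hp0 hp1 a)]
        exact mul_le_mul_of_nonneg_left (h2 _) (bernWeight_nonneg hp0 hp1 a)
    _ = η * ∑ a : Fin n → Fin 2, bernWeight p a + C / (n * δ) ^ 2 *
          ∑ a : Fin n → Fin 2, bernWeight p a * (selCount a 1 - n * p) ^ 2 := by
        rw [Finset.mul_sum, Finset.mul_sum, ← Finset.sum_add_distrib]
        refine Finset.sum_congr rfl fun a _ => ?_
        field_simp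
    _ = η + C * (p * (1 - p)) / (n * δ ^ 2) := by
        rw [sum_bernWeight, sum_bernWeight_mul_sq]
        field_simp
    _ ≤ η + C / (n * δ ^ 2) := by
        gcongr
        refine mul_le_of_le_one_right hC0 ?_
        nlinarith

/-- A law of large numbers for bounded functions of the arm counts. -/
lemma tendsto_sum_bernWeight {ι : Type*} {l : Filter ι} {N : ι → ℕ} (hN : Tendsto N l atTop)
    {p : ι → ℝ} (hp0 : ∀ i, 0 ≤ p i) (hp1 : ∀ i, p i ≤ 1) {q : ℝ} (hp : Tendsto p l (𝓝 q))
    {g : ι → ℝ → ℝ} {C : ℝ} (hC : ∀ i x, |g i x| ≤ C) {L : ℝ}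
    (hg : Tendsto (fun x : ι × ℝ => g x.1 x.2) (l ×ˢ 𝓝 q) (𝓝 L)) :
    Tendsto (fun i => ∑ a : Fin (N i) → Fin 2, bernWeight (p i) a * g i (selCount a 1 / N i)) l
      (𝓝 L) := by
  rw [Metric.tendsto_nhds]
  intro ε hε
  have h1 := (Metric.tendsto_nhds.1 hg) (ε / 2) (by positivity)
  rw [eventually_prod_iff] at h1
  obtain ⟨pa, hpa, pb, hpb, h1⟩ := h1
  obtain ⟨δ, hδ, hpb⟩ := Metric.eventually_nhds_iff.1 hpb
  have h2 : Tendsto (fun i => (C + |L|) / ((N i : ℝ) * (δ / 2) ^ 2)) l (𝓝 0) := by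
    refine Tendsto.div_atTop tendsto_const_nhds ?_
    exact (tendsto_natCast_atTop_atTop.comp hN).atTop_mul_const (by positivity)
  have h3 := (Metric.tendsto_nhds.1 h2) (ε / 2) (by positivity)
  have h4 := (Metric.tendsto_nhds.1 hp) (δ / 2) (by positivity)
  filter_upwards [hpa, h3, h4, hN.eventually_ne_atTop 0] with i hi1 hi3 hi4 hi5
  rw [Real.dist_eq] at hi3 hi4 ⊢
  -- One half of `δ` bounds the deviation of the frequency from `p i`, the other half the distance
  -- from `p i` to `q`.
  have h5 := abs_sum_bernWeight_sub_le hi5 (hp0 i) (hp1 i) (g := g i) (L := L) (C := C + |L|)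
    (η := ε / 2) (δ := δ / 2) (by positivity) (by positivity)
    (fun x => (abs_sub _ _).trans (by linarith [hC i x])) (fun x hx => by
      have : dist x q < δ := by
        rw [Real.dist_eq]
        have := abs_sub_le x (p i) q
        linarith
      have := h1 hi1 (hpb this)
      rw [Real.dist_eq] at this
      exact this.le)
  rw [sub_zero] at hi3
  linarith [le_abs_self ((C + |L|) / ((N i : ℝ) * (δ / 2) ^ 2))]

/-! ### The limit for fixed values of the Gaussian variables -/

lemma continuous_cdf_of_nullSingletonClass (μ : Measure ℝ) [IsProbabilityMeasure μ]
    (hμ : ∀ x, μ {x} = 0) : Continuous (cdf μ) := by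
  rw [continuous_iff_continuousAt]
  intro x
  rw [(monotone_cdf μ).continuousAt_iff_leftLim_eq_rightLim, (cdf μ).rightLim_eq]
  refine le_antisymm ((monotone_cdf μ).leftLim_le le_rfl) ?_
  have h := (cdf μ).measure_singleton x
  rw [measure_cdf, hμ] at h
  have := ENNReal.ofReal_eq_zero.1 h.symm
  linarith

lemma continuous_cdf_gaussianReal : Continuous (cdf (gaussianReal 0 1)) := by
  have := nullSingletonClass_gaussianReal (μ := 0) (v := 1) one_ne_zero
  exact continuous_cdf_of_nullSingletonClass _ fun x => measure_singleton x

lemma continuous_clip (pmin pmax : ℝ) : Continuous (clip pmin pmax) := by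
  unfold clip
  fun_prop

lemma le_clip (pmin pmax x : ℝ) : pmin ≤ clip pmin pmax x := le_max_left _ _

lemma clip_le {pmin pmax : ℝ} (h : pmin ≤ pmax) (x : ℝ) : clip pmin pmax x ≤ pmax :=
  max_le h (min_le_left _ _)

/-- The clipped Thompson probability of arm `1`, in terms of the arm counts `c₁`, `c₀` and the
error sums `E₁`, `E₀` of the first batch. -/
noncomputable def tsProb (pmin pmax : ℝ) (β : Fin 2 → ℝ) (c₁ c₀ E₁ E₀ : ℝ) : ℝ :=
  clip pmin pmax (cdf (gaussianReal 0 1)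
    (((E₁ + β 1 * c₁) / (c₁ + 1) - (E₀ + β 0 * c₀) / (c₀ + 1)) /
      √(1 / (c₀ + 1) + 1 / (c₁ + 1))))

/-- The standardized posterior mean difference at selection frequency `ξ` of arm `1` in a batch
of size `1 / ε`, for zero margin. -/
noncomputable def tsArg (b z₀ z₁ ξ ε : ℝ) : ℝ :=
  (√ξ * z₀ / (ξ + ε) - √(1 - ξ) * z₁ / (1 - ξ + ε)
    + b * √ε * (1 / (1 - ξ + ε) - 1 / (ξ + ε))) / √(1 / (1 - ξ + ε) + 1 / (ξ + ε))

/-- The zero margin enters here. A common arm mean contributes only `β 0 * (1 / (c₀ + 1) - 1 / (c₁ +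
1))`, caused by shrinkage towards the prior. For frequencies away from `0` and `1` this is of order
`1 / n` against a posterior standard deviation of order `1 / √n`, whence the factor `√ε` in `tsArg`.
-/
lemma tsProb_scale {n : ℕ} (hn : n ≠ 0) (pmin pmax : ℝ) {β : Fin 2 → ℝ} (hβ : β 1 = β 0)
    (z₀ z₁ : ℝ) {ξ : ℝ} (h0 : 0 ≤ ξ) (h1 : ξ ≤ 1) :
    tsProb pmin pmax β (n * ξ) (n * (1 - ξ)) (√n * (√ξ * z₀)) (√n * (√(1 - ξ) * z₁))
      = clip pmin pmax (cdf (gaussianReal 0 1) (tsArg (β 0) z₀ z₁ ξ (1 / n))) := by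
  unfold tsProb tsArg
  congr 2
  have hs : 0 < √(n : ℝ) := by positivity
  have hs2 : (n : ℝ) = √(n : ℝ) ^ 2 := by rw [Real.sq_sqrt]; positivity
  have h2 : 0 ≤ 1 - ξ := by linarith
  have e1 : √(1 / (n : ℝ)) = 1 / √(n : ℝ) := by rw [Real.sqrt_div zero_le_one, Real.sqrt_one]
  have e2 : 1 / (n * (1 - ξ) + 1) + 1 / (n * ξ + 1)
      = (1 / (1 - ξ + 1 / n) + 1 / (ξ + 1 / n)) / (n : ℝ) := by
    have : (n : ℝ) ≠ 0 := by positivity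
    field_simp
  rw [e2, Real.sqrt_div (by positivity), e1, hβ]
  have h3 : 0 < √(1 / (1 - ξ + 1 / (n : ℝ)) + 1 / (ξ + 1 / n)) := by
    apply Real.sqrt_pos.2
    have : 0 < (n : ℝ) := by positivity
    positivity
  rw [div_div_eq_mul_div]
  congr 1
  rw [hs2]
  have h4 : √(√(n : ℝ) ^ 2) = √(n : ℝ) := by rw [← hs2]
  rw [h4]
  set s := √(n : ℝ)
  field_simp
  ring

/-- Counts of order `n` and error sums of order `√n` leave the statistic unchanged, so the batch
size disappears and the limit is a matter of continuity. -/
lemma zForm_scale {n : ℕ} (hn : n ≠ 0) (c₁ c₀ E₁ E₀ : ℝ) :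
    zForm n (n * c₁) (n * c₀) (√n * E₁) (√n * E₀) = zForm 1 c₁ c₀ E₁ E₀ := by
  have hs : 0 < √(n : ℝ) := by positivity
  have hn' : (n : ℝ) ≠ 0 := by positivity
  unfold zForm
  have e1 : n * c₁ * (n * c₀) / (2 * n) = n * (c₁ * c₀ / (2 * ((1 : ℕ) : ℝ))) := by
    push_cast
    field_simp
  have e2 : ∀ E c : ℝ, √n * E / (n * c) = E / c / √n := fun E c => by
    rw [mul_comm (n : ℝ), div_div, mul_comm c, ← div_div, ← div_div]
    nth_rewrite 2 [← Real.mul_self_sqrt (Nat.cast_nonneg n)]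
    field_simp
  rw [e1, Real.sqrt_mul (Nat.cast_nonneg n), e2, e2]
  field_simp

lemma zForm_one_eq {c₁ c₀ : ℝ} (h₁ : 0 < c₁) (h₀ : 0 < c₀) (E₁ E₀ : ℝ) :
    zForm 1 c₁ c₀ E₁ E₀ = √(c₀ / (2 * c₁)) * E₁ - √(c₁ / (2 * c₀)) * E₀ := by
  have h : ∀ a b : ℝ, 0 < a → √(b / (2 * a)) = √(a * b / 2) / a := fun a b ha => by
    rw [← Real.sqrt_sq ha.le, ← Real.sqrt_div' _ (by positivity), Real.sqrt_sq ha.le]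
    congr 1
    field_simp
  rw [h _ _ h₁, h _ _ h₀, zForm, mul_comm c₀ c₁]
  push_cast
  rw [mul_one]
  ring

lemma tsArg_half_zero (b z₀ z₁ : ℝ) : tsArg b z₀ z₁ (1 / 2) 0 = (z₀ - z₁) / √2 := by
  unfold tsArg
  have e1 : (1 : ℝ) - 1 / 2 = 1 / 2 := by norm_num
  have e2 : (1 : ℝ) / (1 / 2 + 0) + 1 / (1 / 2 + 0) = 2 ^ 2 := by norm_num
  rw [e1, e2, Real.sqrt_sq (by norm_num), Real.sqrt_div zero_le_one, Real.sqrt_one]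
  simp
  ring

lemma continuousAt_tsArg (b z₀ z₁ : ℝ) :
    ContinuousAt (fun y : ℝ × ℝ => tsArg b z₀ z₁ y.1 y.2) (1 / 2, 0) := by
  have hA : (1 / 2 + 0 : ℝ) ≠ 0 := by norm_num
  have hB : (1 - 1 / 2 + 0 : ℝ) ≠ 0 := by norm_num
  have hAB : √(1 / (1 - 1 / 2 + 0) + 1 / (1 / 2 + 0) : ℝ) ≠ 0 := by
    rw [Real.sqrt_ne_zero']
    norm_num
  have c1 : ContinuousAt (fun y : ℝ × ℝ => y.1 + y.2) (1 / 2, 0) := by fun_prop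
  have c2 : ContinuousAt (fun y : ℝ × ℝ => 1 - y.1 + y.2) (1 / 2, 0) := by fun_prop
  have c3 : ContinuousAt (fun y : ℝ × ℝ => √y.1 * z₀) (1 / 2, 0) := by fun_prop
  have c4 : ContinuousAt (fun y : ℝ × ℝ => √(1 - y.1) * z₁) (1 / 2, 0) := by fun_prop
  have c5 : ContinuousAt (fun y : ℝ × ℝ => b * √y.2) (1 / 2, 0) := by fun_prop
  have c6 := (continuousAt_const (y := (1 : ℝ))).div c2 hB
  have c7 := (continuousAt_const (y := (1 : ℝ))).div c1 hA
  exact (((c3.div c1 hA).sub (c4.div c2 hB)).add (c5.mul (c6.sub c7))).div (c6.add c7).sqrt hAB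

lemma tendsto_tsArg (b z₀ z₁ : ℝ) :
    Tendsto (fun x : ℕ × ℝ => tsArg b z₀ z₁ x.2 (1 / x.1)) (atTop ×ˢ 𝓝 (1 / 2))
      (𝓝 ((z₀ - z₁) / √2)) := by
  have h1 : Tendsto (fun x : ℕ × ℝ => (x.2, 1 / (x.1 : ℝ))) (atTop ×ˢ 𝓝 (1 / 2))
      (𝓝 (1 / 2, 0)) :=
    tendsto_snd.prodMk_nhds (tendsto_one_div_atTop_nhds_zero_nat.comp tendsto_fst)
  have h2 := (continuousAt_tsArg b z₀ z₁).tendsto.comp h1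
  rwa [tsArg_half_zero] at h2

/-- The conditional expectation of `f` of the Z-statistic given the four Gaussian variables. -/
noncomputable def condMean (n : ℕ) (pmin pmax : ℝ) (β : Fin 2 → ℝ) (f : ℝ → ℝ)
    (x y : ℝ × ℝ) : ℝ :=
  ∑ a : Fin n → Fin 2, bernWeight (1 / 2) a * ∑ a' : Fin n → Fin 2,
    bernWeight (tsProb pmin pmax β (selCount a 1) (selCount a 0)
      (√(selCount a 1) * x.1) (√(selCount a 0) * x.2)) a' *
    f (zForm n (selCount a 1 + selCount a' 1) (selCount a 0 + selCount a' 0)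
      (√(selCount a 1) * x.1 + √(selCount a' 1) * y.1)
      (√(selCount a 0) * x.2 + √(selCount a' 0) * y.2))

lemma abs_sum_bernWeight_mul_le {n : ℕ} {p : ℝ} (h0 : 0 ≤ p) (h1 : p ≤ 1)
    {g : (Fin n → Fin 2) → ℝ} {C : ℝ} (hg : ∀ a, |g a| ≤ C) :
    |∑ a, bernWeight p a * g a| ≤ C := by
  calc |∑ a, bernWeight p a * g a| ≤ ∑ a, bernWeight p a * C := by
        refine (Finset.abs_sum_le_sum_abs _ _).trans (Finset.sum_le_sum fun a _ => ?_)
        rw [abs_mul, abs_of_nonneg (bernWeight_nonneg h0 h1 a)]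
        exact mul_le_mul_of_nonneg_left (hg a) (bernWeight_nonneg h0 h1 a)
    _ = C := by rw [← Finset.sum_mul, sum_bernWeight, one_mul]

section Limit

variable {pmin pmax : ℝ} (hpmin : 0 < pmin) (hle : pmin ≤ pmax) (hpmax : pmax < 1)
include hpmin hle hpmax

lemma abs_condMean_le (n : ℕ) (β : Fin 2 → ℝ) {f : ℝ → ℝ} {C : ℝ}
    (hf : ∀ x, |f x| ≤ C) (x y : ℝ × ℝ) : |condMean n pmin pmax β f x y| ≤ C := by
  refine abs_sum_bernWeight_mul_le (by norm_num) (by norm_num) fun a => ?_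
  refine abs_sum_bernWeight_mul_le (hpmin.le.trans (le_clip _ _ _))
    ((clip_le hle _).trans hpmax.le) fun a' => hf _

lemma tendsto_condMean {β : Fin 2 → ℝ} (hβ : β 1 = β 0) {f : ℝ → ℝ} (hfc : Continuous f)
    {C : ℝ} (hf : ∀ x, |f x| ≤ C) (x y : ℝ × ℝ) :
    Tendsto (fun n => condMean n pmin pmax β f x y) atTop
      (𝓝 (f (limitVar pmin pmax ![x.1, x.2, y.1, y.2]))) := by
  set q := piStar pmin pmax ![x.1, x.2, y.1, y.2] with hq
  have hq0 : 0 < q := hpmin.trans_le (le_clip _ _ _)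
  have hq1 : q < 1 := (clip_le hle _).trans_lt hpmax
  let pr : ℕ × ℝ → ℝ := fun u =>
    clip pmin pmax (cdf (gaussianReal 0 1) (tsArg (β 0) x.1 x.2 u.2 (1 / u.1)))
  let H : ℝ → ℝ → ℝ := fun ξ υ => zForm 1 (ξ + υ) ((1 - ξ) + (1 - υ))
    (√ξ * x.1 + √υ * y.1) (√(1 - ξ) * x.2 + √(1 - υ) * y.2)
  have hpr : Tendsto pr (atTop ×ˢ 𝓝 (1 / 2)) (𝓝 q) :=
    (((continuous_clip pmin pmax).comp continuous_cdf_gaussianReal).tendsto _).comp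
      (tendsto_tsArg (β 0) x.1 x.2)
  have hH : ContinuousAt (fun w : ℝ × ℝ => H w.1 w.2) (1 / 2, q) := by
    simp only [H, zForm]
    have h1 : (1 / 2 + q : ℝ) ≠ 0 := by positivity
    have h2 : ((1 - 1 / 2) + (1 - q) : ℝ) ≠ 0 := by linarith
    fun_prop (disch := assumption)
  have hHq : H (1 / 2) q = limitVar pmin pmax ![x.1, x.2, y.1, y.2] := by
    have e1 : (1 : ℝ) - 1 / 2 = 1 / 2 := by norm_num
    simp only [H]
    rw [zForm_one_eq (by linarith) (by linarith), e1]
    simp [limitVar, ← hq]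
  rw [← hHq]
  -- the inner sum
  have inner := tendsto_sum_bernWeight (l := atTop ×ˢ 𝓝 (1 / 2 : ℝ)) (N := fun u : ℕ × ℝ => u.1)
    tendsto_fst (p := pr) (fun u => hpmin.le.trans (le_clip _ _ _))
    (fun u => (clip_le hle _).trans hpmax.le) hpr (g := fun u υ => f (H u.2 υ))
    (fun u υ => hf _) (L := f (H (1 / 2) q))
    (by
      have h1 : Tendsto (fun v : (ℕ × ℝ) × ℝ => (v.1.2, v.2))
          ((atTop ×ˢ 𝓝 (1 / 2)) ×ˢ 𝓝 q) (𝓝 (1 / 2, q)) :=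
        (tendsto_snd.comp tendsto_fst).prodMk_nhds tendsto_snd
      exact (hfc.tendsto _).comp (hH.tendsto.comp h1))
  -- The first-batch frequency `ξ` was a free variable near `1/2` in `inner`, so the conclusion of
  -- `inner` along the product filter is exactly the joint limit required here.
  have outer := tendsto_sum_bernWeight (l := atTop) (N := fun n : ℕ => n) tendsto_id
    (p := fun _ => 1 / 2) (fun _ => by norm_num) (fun _ => by norm_num) tendsto_const_nhds
    (g := fun n ξ => ∑ a' : Fin n → Fin 2,
      bernWeight (pr (n, ξ)) a' * f (H ξ (selCount a' 1 / n))) (C := C)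
    (fun n ξ => abs_sum_bernWeight_mul_le (hpmin.le.trans (le_clip _ _ _))
      ((clip_le hle _).trans hpmax.le) fun a' => hf _) inner
  refine outer.congr' ?_
  filter_upwards [eventually_ne_atTop 0] with n hn
  unfold condMean
  have hn' : (n : ℝ) ≠ 0 := by positivity
  have hfreq : ∀ a : Fin n → Fin 2, ∃ ξ : ℝ, 0 ≤ ξ ∧ ξ ≤ 1 ∧ selCount a 1 / n = ξ ∧
      selCount a 1 = n * ξ ∧ selCount a 0 = n * (1 - ξ) := fun a => by
    refine ⟨selCount a 1 / n, div_nonneg (selCount_nonneg _ _) (by positivity),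
      div_le_one_of_le₀ (selCount_le _ _) (by positivity), rfl, by field_simp, ?_⟩
    rw [selCount_zero]
    field_simp
  refine Finset.sum_congr rfl fun a _ => ?_
  congr 1
  obtain ⟨ξ, h0, h1, e1, e2, e3⟩ := hfreq a
  rw [e1, e2, e3]
  refine Finset.sum_congr rfl fun a' _ => ?_
  obtain ⟨υ, h0', h1', e1', e2', e3'⟩ := hfreq a'
  rw [e1', e2', e3']
  have hsq : ∀ t : ℝ, √(n * t) = √n * √t := fun t => Real.sqrt_mul (Nat.cast_nonneg n) t
  rw [hsq, hsq, hsq, hsq, mul_assoc, mul_assoc, mul_assoc, mul_assoc,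
    tsProb_scale hn pmin pmax hβ _ _ h0 h1, ← mul_add, ← mul_add, ← mul_add, ← mul_add,
    zForm_scale hn]

end Limit

/-! ### Convergence in distribution -/

lemma measurable_tsProb (pmin pmax : ℝ) (β : Fin 2 → ℝ) (c₁ c₀ : ℝ) :
    Measurable fun x : ℝ × ℝ => tsProb pmin pmax β c₁ c₀ x.1 x.2 := by
  unfold tsProb
  refine (continuous_clip pmin pmax).measurable.comp (continuous_cdf_gaussianReal.measurable.comp ?_)
  fun_prop

lemma measurable_limitVar (pmin pmax : ℝ) : Measurable (limitVar pmin pmax) := by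
  have hq : Measurable (piStar pmin pmax) := by
    unfold piStar
    refine (continuous_clip pmin pmax).measurable.comp
      (continuous_cdf_gaussianReal.measurable.comp ?_)
    fun_prop
  unfold limitVar
  fun_prop

/-! ### Integration against normals that do not depend on the batch size -/

/-- The law of two independent standard normal variables. -/
noncomputable abbrev stdNormal2 : Measure (ℝ × ℝ) := (gaussianReal 0 1).prod (gaussianReal 0 1)

/-- The pair of error sums of the two arms. -/
noncomputable def armSums {n : ℕ} (a : Fin n → Fin 2) (e : Fin n → ℝ) : ℝ × ℝ :=
  (armSum a e 1, armSum a e 0)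

/-- Rescaling of two standard normals to the law of the error sums of the two arms. -/
noncomputable def armScale {n : ℕ} (a : Fin n → Fin 2) (x : ℝ × ℝ) : ℝ × ℝ :=
  (√(selCount a 1) * x.1, √(selCount a 0) * x.2)

lemma measurable_armSums {n : ℕ} (a : Fin n → Fin 2) : Measurable (armSums a) :=
  (measurable_armSum a 1).prodMk (measurable_armSum a 0)

lemma measurable_armScale {n : ℕ} (a : Fin n → Fin 2) : Measurable (armScale a) := by
  unfold armScale
  fun_prop

lemma integral_armSums {n : ℕ} (a : Fin n → Fin 2) {g : ℝ × ℝ → ℝ} (hg : Measurable g) :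
    ∫ e, g (armSums a e) ∂(errLaw n) = ∫ x, g (armScale a x) ∂stdNormal2 :=
  integral_armSum a hg

/-- Every pair of action vectors uses the same two pairs of normals, only rescaled. The integrals
can therefore be moved outside the finite sums, which leaves an average over actions for fixed
normals. -/
lemma sum_integral_armSums {n : ℕ} {Q : (Fin n → Fin 2) → ℝ × ℝ → ℝ} (hQ : ∀ a, Measurable (Q a))
    (hQ0 : ∀ a x, 0 ≤ Q a x) (hQ1 : ∀ a x, Q a x ≤ 1)
    {F : (Fin n → Fin 2) → (Fin n → Fin 2) → (ℝ × ℝ) × (ℝ × ℝ) → ℝ}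
    (hF : ∀ a a', Measurable (F a a')) {C : ℝ} (hC : ∀ a a' u, |F a a' u| ≤ C) :
    ∑ a, bernWeight (1 / 2) a * ∫ e, ∑ a', bernWeight (Q a (armSums a e)) a' *
        ∫ e', F a a' (armSums a e, armSums a' e') ∂(errLaw n) ∂(errLaw n)
      = ∫ x, ∫ y, ∑ a, bernWeight (1 / 2) a * ∑ a', bernWeight (Q a (armScale a x)) a' *
          F a a' (armScale a x, armScale a' y) ∂stdNormal2 ∂stdNormal2 := by
  have hGm : ∀ a a', Measurable fun x => ∫ y, F a a' (x, armScale a' y) ∂stdNormal2 :=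
    fun a a' => by
      have : Measurable fun u : (ℝ × ℝ) × (ℝ × ℝ) => F a a' (u.1, armScale a' u.2) :=
        (hF a a').comp (measurable_fst.prodMk ((measurable_armScale a').comp measurable_snd))
      exact this.stronglyMeasurable.integral_prod_right'.measurable
  have hwm : ∀ a, Measurable fun x => ∑ a', bernWeight (Q a x) a' *
      ∫ y, F a a' (x, armScale a' y) ∂stdNormal2 := fun a =>
    Finset.measurable_sum _ fun a' _ => ((measurable_bernWeight a').comp (hQ a)).mul (hGm a a')
  have s3 : ∀ a : Fin n → Fin 2, ∫ e, ∑ a', bernWeight (Q a (armSums a e)) a' *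
        ∫ e', F a a' (armSums a e, armSums a' e') ∂(errLaw n) ∂(errLaw n)
      = ∫ x, ∑ a', bernWeight (Q a (armScale a x)) a' *
          ∫ y, F a a' (armScale a x, armScale a' y) ∂stdNormal2 ∂stdNormal2 := fun a => by
    rw [← integral_armSums a (hwm a)]
    refine integral_congr_ae (ae_of_all _ fun e => Finset.sum_congr rfl fun a' _ => ?_)
    exact congrArg _ (integral_armSums a' (g := fun v => F a a' (armSums a e, v))
      ((hF a a').comp (measurable_const.prodMk measurable_id)))
  have hFi : ∀ (a a' : Fin n → Fin 2) (v : ℝ × ℝ),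
      Integrable (fun y => F a a' (v, armScale a' y)) stdNormal2 := fun a a' v =>
    Integrable.of_bound ((hF a a').comp
      (measurable_const.prodMk (measurable_armScale a'))).aestronglyMeasurable
      C (ae_of_all _ fun y => hC _ _ _)
  have hx : ∀ a : Fin n → Fin 2, Integrable (fun x => ∑ a', bernWeight (Q a (armScale a x)) a' *
      ∫ y, F a a' (armScale a x, armScale a' y) ∂stdNormal2) stdNormal2 := fun a =>
    Integrable.of_bound ((hwm a).comp (measurable_armScale a)).aestronglyMeasurable
      C (ae_of_all _ fun x => abs_sum_bernWeight_mul_le (hQ0 _ _) (hQ1 _ _) fun a' =>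
        abs_integral_le_of_bound fun y => hC _ _ _)
  have s4 : ∀ x, ∫ y, ∑ a, bernWeight (1 / 2) a * ∑ a', bernWeight (Q a (armScale a x)) a' *
          F a a' (armScale a x, armScale a' y) ∂stdNormal2
      = ∑ a, bernWeight (1 / 2) a * ∑ a', bernWeight (Q a (armScale a x)) a' *
          ∫ y, F a a' (armScale a x, armScale a' y) ∂stdNormal2 := fun x => by
    have hi : ∀ a a', Integrable (fun y => bernWeight (Q a (armScale a x)) a' *
        F a a' (armScale a x, armScale a' y)) stdNormal2 := fun a a' => (hFi a a' _).const_mul _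
    rw [integral_finsetSum _ fun a _ => (integrable_finsetSum _ fun a' _ => hi a a').const_mul _]
    refine Finset.sum_congr rfl fun a _ => ?_
    rw [integral_const_mul, integral_finsetSum _ fun a' _ => hi a a']
    exact congrArg _ (Finset.sum_congr rfl fun a' _ => integral_const_mul _ _)
  rw [integral_congr_ae (ae_of_all _ s4), integral_finsetSum _ fun a _ => (hx a).const_mul _]
  refine Finset.sum_congr rfl fun a _ => ?_
  rw [integral_const_mul, s3]

/-- The first batch influences the second only through its counts and error sums, which is what
makes the reduction to four normals possible. -/
lemma thompsonProb_one_eq {Ω : Type*} {n : ℕ} (pmin pmax : ℝ) (β : Fin 2 → ℝ)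
    (A : Fin 2 → Fin n → Ω → Fin 2) (R : Fin 2 → Fin n → Ω → ℝ) (ω : Ω) :
    thompsonProb pmin pmax A R 1 ω = tsProb pmin pmax β
      (selCount (actions A 0 ω) 1) (selCount (actions A 0 ω) 0)
      (armSum (actions A 0 ω) (err β A R 0 ω) 1) (armSum (actions A 0 ω) (err β A R 0 ω) 0) := by
  have h : thompsonProb pmin pmax A R 1 ω
      = clip pmin pmax (posteriorProb (actions A 0 ω) fun i => R 0 i ω) := rfl
  rw [h, posteriorProb_eq, reward_sum_eq β, reward_sum_eq β, tsProb]

section Expectation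

variable {Ω : Type*} {n : ℕ} [MeasurableSpace Ω] {P : Measure Ω}
  {pmin pmax : ℝ} {β : Fin 2 → ℝ} {A : Fin 2 → Fin n → Ω → Fin 2} {R : Fin 2 → Fin n → Ω → ℝ}

lemma measurable_zStat {p : Fin 2 → Ω → ℝ} (h : IsGaussianBandit P β p A R) :
    Measurable (zStat 1 β A R) := by
  have hsel : ∀ t b, Measurable fun ω => selCount (actions A t ω) b := fun t b =>
    (measurable_of_countable fun a : Fin n → Fin 2 => selCount a b).comp (h.measurable_actions t)
  have hsum : ∀ t b, Measurable fun ω => armSum (actions A t ω) (err β A R t ω) b := fun t b => by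
    have : Measurable fun x : (Fin n → Fin 2) × (Fin n → ℝ) => armSum x.1 x.2 b :=
      measurable_from_prod_countable_right fun a => measurable_armSum a b
    exact this.comp ((h.measurable_actions t).prodMk (h.measurable_err t))
  have : zStat 1 β A R = _ := funext (zStat_eq β A R)
  rw [this]
  unfold zForm
  have h00 := hsel 0 0
  have h01 := hsel 0 1
  have h10 := hsel 1 0
  have h11 := hsel 1 1
  have k00 := hsum 0 0
  have k01 := hsum 0 1
  have k10 := hsum 1 0
  have k11 := hsum 1 1
  fun_prop

lemma integral_zStat [IsProbabilityMeasure P] (hpmin : 0 < pmin) (hle : pmin ≤ pmax) (hpmax : pmax < 1)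
    (h : IsGaussianBandit P β (thompsonProb pmin pmax A R) A R) {f : ℝ → ℝ} (hfm : Measurable f)
    {C : ℝ} (hf : ∀ x, |f x| ≤ C) :
    ∫ ω, f (zStat 1 β A R ω) ∂P
      = ∫ x, ∫ y, condMean n pmin pmax β f x y ∂stdNormal2 ∂stdNormal2 := by
  let F : (Fin n → Fin 2) → (Fin n → Fin 2) → (ℝ × ℝ) × (ℝ × ℝ) → ℝ := fun a a' u =>
    f (zForm n (selCount a 1 + selCount a' 1) (selCount a 0 + selCount a' 0)
      (u.1.1 + u.2.1) (u.1.2 + u.2.2))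
  let Q : (Fin n → Fin 2) → ℝ × ℝ → ℝ := fun a x =>
    tsProb pmin pmax β (selCount a 1) (selCount a 0) x.1 x.2
  have hFm : ∀ a a', Measurable (F a a') := fun a a' => by
    have h1 : Measurable fun u : (ℝ × ℝ) × (ℝ × ℝ) => (u.1.1 + u.2.1, u.1.2 + u.2.2) := by
      fun_prop
    exact (hfm.comp (measurable_zForm n _ _)).comp h1
  have hQm : ∀ a, Measurable (Q a) := fun a => measurable_tsProb _ _ _ _ _
  have hQ0 : ∀ a x, 0 ≤ Q a x := fun _ _ => hpmin.le.trans (le_clip _ _ _)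
  have hQ1 : ∀ a x, Q a x ≤ 1 := fun _ _ => (clip_le hle _).trans hpmax.le
  have hC : ∀ a a' u, |F a a' u| ≤ C := fun _ _ _ => hf _
  have s1 := h.integral_data (q := fun a e => Q a (armSums a e))
    (fun a => (hQm a).comp (measurable_armSums a)) (fun _ _ => hQ0 _ _) (fun _ _ => hQ1 _ _)
    rfl (thompsonProb_one_eq pmin pmax β A R)
    (F := fun a a' e => F a a' (armSums a e.1, armSums a' e.2))
    (fun a a' => (hFm a a').comp (((measurable_armSums a).comp measurable_fst).prodMk
      ((measurable_armSums a').comp measurable_snd))) (C := C) fun _ _ _ => hC _ _ _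
  have s2 := sum_integral_armSums hQm hQ0 hQ1 hFm hC
  calc ∫ ω, f (zStat 1 β A R ω) ∂P = _ :=
        integral_congr_ae (ae_of_all _ fun ω => congrArg f (zStat_eq β A R ω))
    _ = _ := s1
    _ = _ := s2

end Expectation

lemma measurable_condMean (n : ℕ) (pmin pmax : ℝ) (β : Fin 2 → ℝ) {f : ℝ → ℝ}
    (hf : Measurable f) :
    Measurable fun u : (ℝ × ℝ) × (ℝ × ℝ) => condMean n pmin pmax β f u.1 u.2 := by
  unfold condMean
  refine Finset.measurable_sum _ fun a _ => measurable_const.mul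
    (Finset.measurable_sum _ fun a' _ => ?_)
  have h1 : Measurable fun u : (ℝ × ℝ) × (ℝ × ℝ) =>
      (√(selCount a 1) * u.1.1, √(selCount a 0) * u.1.2) := by fun_prop
  have h2 : Measurable fun u : (ℝ × ℝ) × (ℝ × ℝ) =>
      (√(selCount a 1) * u.1.1 + √(selCount a' 1) * u.2.1,
        √(selCount a 0) * u.1.2 + √(selCount a' 0) * u.2.2) := by fun_prop
  exact ((measurable_bernWeight a').comp ((measurable_tsProb pmin pmax β _ _).comp h1)).mul
    ((hf.comp (measurable_zForm n _ _)).comp h2)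

lemma integral_stdNormal4 {g : (Fin 4 → ℝ) → ℝ} (hg : Measurable g) :
    ∫ z, g z ∂stdNormal4 = ∫ u, g ![u.1.1, u.1.2, u.2.1, u.2.2]
      ∂(stdNormal2.prod stdNormal2) := by
  have hm : Measurable fun x : (ℝ × ℝ) × (ℝ × ℝ) => ![x.1.1, x.1.2, x.2.1, x.2.2] := by
    refine measurable_pi_lambda _ fun i => ?_
    fin_cases i <;> simp <;> fun_prop
  rw [map_stdNormal4, integral_map hm.aemeasurable hg.aestronglyMeasurable]

theorem tendstoInDistribution_zStat {Ω : ℕ → Type*} [∀ n, MeasurableSpace (Ω n)]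
    (P : (n : ℕ) → Measure (Ω n)) [∀ n, IsProbabilityMeasure (P n)]
    {pmin pmax : ℝ} (hpmin : 0 < pmin) (hle : pmin ≤ pmax) (hpmax : pmax < 1)
    (β : Fin 2 → ℝ)
    (A : (n : ℕ) → Fin 2 → Fin n → Ω n → Fin 2) (R : (n : ℕ) → Fin 2 → Fin n → Ω n → ℝ)
    (hbandit : ∀ n, IsGaussianBandit (P n) β (thompsonProb pmin pmax (A n) (R n)) (A n) (R n))
    (hmargin : β 1 = β 0) :
    TendstoInDistribution (fun n => zStat 1 β (A n) (R n)) atTop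
        (limitVar pmin pmax) P stdNormal4 where
  forall_aemeasurable n := (measurable_zStat (hbandit n)).aemeasurable
  aemeasurable_limit := (measurable_limitVar pmin pmax).aemeasurable
  tendsto := by
    refine ProbabilityMeasure.tendsto_iff_forall_integral_tendsto.2 fun f => ?_
    have hfm : Measurable f := f.continuous.measurable
    have hf : ∀ x, |f x| ≤ ‖f‖ := fun x => f.norm_coe_le_norm x
    simp only [ProbabilityMeasure.coe_mk]
    have e1 : ∀ n, ∫ x, f x ∂((P n).map (zStat 1 β (A n) (R n)))
        = ∫ u, condMean n pmin pmax β f u.1 u.2 ∂(stdNormal2.prod stdNormal2) := fun n => by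
      have hi : Integrable (fun u : (ℝ × ℝ) × (ℝ × ℝ) => condMean n pmin pmax β f u.1 u.2)
          (stdNormal2.prod stdNormal2) :=
        Integrable.of_bound (measurable_condMean n pmin pmax β hfm).aestronglyMeasurable ‖f‖
          (ae_of_all _ fun u => abs_condMean_le hpmin hle hpmax n β hf _ _)
      rw [integral_map (measurable_zStat (hbandit n)).aemeasurable hfm.aestronglyMeasurable,
        integral_zStat hpmin hle hpmax (hbandit n) hfm hf, integral_prod _ hi]
    have e2 : ∫ x, f x ∂(stdNormal4.map (limitVar pmin pmax))
        = ∫ u, f (limitVar pmin pmax ![u.1.1, u.1.2, u.2.1, u.2.2])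
          ∂(stdNormal2.prod stdNormal2) := by
      rw [integral_map (measurable_limitVar pmin pmax).aemeasurable hfm.aestronglyMeasurable]
      exact integral_stdNormal4 (hfm.comp (measurable_limitVar pmin pmax))
    simp_rw [e1]
    rw [e2]
    -- `condMean` is a weighted average of values of `f`, hence bounded by `‖f‖` uniformly in `n`.
    refine tendsto_integral_of_dominated_convergence (fun _ => ‖f‖)
      (fun n => (measurable_condMean n pmin pmax β hfm).aestronglyMeasurable) (integrable_const _)
      (fun n => ae_of_all _ fun u => abs_condMean_le hpmin hle hpmax n β hf _ _)
      (ae_of_all _ fun u => ?_)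
    exact tendsto_condMean hpmin hle hpmax hmargin f.continuous hf u.1 u.2

/-! ### The exponential moments of the limit -/

lemma lintegral_exp_gaussianReal (c α : ℝ) :
    ∫⁻ x, ENNReal.ofReal (Real.exp (c + α * x)) ∂(gaussianReal 0 1)
      = ENNReal.ofReal (Real.exp (c + α ^ 2 / 2)) := by
  have h1 : ∫ x, Real.exp (α * x) ∂(gaussianReal 0 1) = Real.exp (α ^ 2 / 2) := by
    have := congrFun (mgf_fun_id_gaussianReal (μ := 0) (v := 1)) α
    simpa [mgf] using this
  have h2 := (integrable_exp_mul_gaussianReal (μ := 0) (v := 1) α).const_mul (Real.exp c)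
  simp_rw [Real.exp_add]
  rw [← ofReal_integral_eq_lintegral_ofReal h2 (ae_of_all _ fun x => by positivity),
    integral_const_mul, h1]

lemma lintegral_exp_stdNormal2 (c α β : ℝ) :
    ∫⁻ y, ENNReal.ofReal (Real.exp (c + α * y.1 + β * y.2)) ∂stdNormal2
      = ENNReal.ofReal (Real.exp (c + α ^ 2 / 2 + β ^ 2 / 2)) := by
  rw [lintegral_prod _ (by fun_prop)]
  simp_rw [lintegral_exp_gaussianReal]
  simp_rw [show ∀ x, c + α * x + β ^ 2 / 2 = (c + β ^ 2 / 2) + α * x from fun x => by ring]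
  rw [lintegral_exp_gaussianReal]
  congr 2
  ring

lemma lintegral_stdNormal4 {g : (Fin 4 → ℝ) → ENNReal} (hg : Measurable g) :
    ∫⁻ z, g z ∂stdNormal4
      = ∫⁻ x, ∫⁻ y, g ![x.1, x.2, y.1, y.2] ∂stdNormal2 ∂stdNormal2 := by
  have hm : Measurable fun x : (ℝ × ℝ) × (ℝ × ℝ) => ![x.1.1, x.1.2, x.2.1, x.2.2] := by
    refine measurable_pi_lambda _ fun i => ?_
    fin_cases i <;> simp <;> fun_prop
  rw [map_stdNormal4, lintegral_map hg hm]
  exact lintegral_prod _ (hg.comp hm).aemeasurable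

lemma lintegral_stdNormal2_rotate {g : ℝ × ℝ → ENNReal} (hg : Measurable g) :
    ∫⁻ x, g x ∂stdNormal2
      = ∫⁻ x, ∫⁻ y, g (√2 / 2 * (x + y), √2 / 2 * (y - x)) ∂(gaussianReal 0 1)
          ∂(gaussianReal 0 1) := by
  have h1 := IsGaussian.map_rotation_eq_self (μ := gaussianReal 0 1) (by simp) (Real.pi / 4)
  have h2 : ∀ x : ℝ × ℝ, ContinuousLinearMap.rotation (Real.pi / 4) x
      = (√2 / 2 * (x.1 + x.2), √2 / 2 * (x.2 - x.1)) := fun x => by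
    rw [ContinuousLinearMap.rotation_apply]
    ext <;> simp <;> ring
  have hl : Measurable fun x : ℝ × ℝ => (√2 / 2 * (x.1 + x.2), √2 / 2 * (x.2 - x.1)) := by
    fun_prop
  calc ∫⁻ x, g x ∂stdNormal2 = ∫⁻ x, g (√2 / 2 * (x.1 + x.2), √2 / 2 * (x.2 - x.1)) ∂stdNormal2 := by
        conv_lhs => rw [stdNormal2, ← h1, lintegral_map hg (by fun_prop)]
        simp_rw [h2]
    _ = _ := lintegral_prod _ (hg.comp hl).aemeasurable

/-- The regression slope of the limit on `(Z₁ - Z₂) / √2` when the second sampling probability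
is `q`. -/
noncomputable def slopeOf (q : ℝ) : ℝ := √(1 / (2 * ((1 / 2 + q) * (1 / 2 + (1 - q)))))

/-- The clipped normal distribution function. -/
noncomputable def clipCdf (pmin pmax x : ℝ) : ℝ := clip pmin pmax (cdf (gaussianReal 0 1) x)

/-- Write `a`, `b` for the two roots. With `Z₁, Z₂ = (W ± X) / √2`, the first-batch part of the
limit is `(a + b) / 2 * X + (a - b) / 2 * W`. So the identities give the conditional mean and
variance given `X`; they follow from `a * b = 1 / 2` and the values of `a ^ 2` and `b ^ 2`. -/
lemma slope_identities {q : ℝ} (h0 : 0 ≤ q) (h1 : q ≤ 1) :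
    √((1 / 2 + (1 - q)) / (2 * (1 / 2 + q))) + √((1 / 2 + q) / (2 * (1 / 2 + (1 - q))))
        = 2 * slopeOf q ∧
      √((1 / 2 + (1 - q)) / (2 * (1 / 2 + q))) ^ 2 * q
        + √((1 / 2 + q) / (2 * (1 / 2 + (1 - q)))) ^ 2 * (1 - q)
        + (√((1 / 2 + (1 - q)) / (2 * (1 / 2 + q)))
            - √((1 / 2 + q) / (2 * (1 / 2 + (1 - q))))) ^ 2 / 4 = 1 - slopeOf q ^ 2 := by
  have hu : 0 < 1 / 2 + q := by linarith
  have hw : 0 < 1 / 2 + (1 - q) := by linarith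
  have hs2 : slopeOf q ^ 2 = 1 / (2 * ((1 / 2 + q) * (1 / 2 + (1 - q)))) := by
    rw [slopeOf, Real.sq_sqrt (by positivity)]
  have hs0 : 0 ≤ slopeOf q := Real.sqrt_nonneg _
  have ha0 := Real.sqrt_nonneg ((1 / 2 + (1 - q)) / (2 * (1 / 2 + q)))
  have hb0 := Real.sqrt_nonneg ((1 / 2 + q) / (2 * (1 / 2 + (1 - q))))
  have ha2 := Real.sq_sqrt (show 0 ≤ (1 / 2 + (1 - q)) / (2 * (1 / 2 + q)) by positivity)
  have hb2 := Real.sq_sqrt (show 0 ≤ (1 / 2 + q) / (2 * (1 / 2 + (1 - q))) by positivity)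
  have hab : √((1 / 2 + (1 - q)) / (2 * (1 / 2 + q))) *
      √((1 / 2 + q) / (2 * (1 / 2 + (1 - q)))) = 1 / 2 := by
    rw [← Real.sqrt_mul (by positivity)]
    have : (1 / 2 + (1 - q)) / (2 * (1 / 2 + q)) * ((1 / 2 + q) / (2 * (1 / 2 + (1 - q))))
        = (1 / 2) ^ 2 := by
      rw [div_mul_div_comm, div_eq_iff (by positivity)]
      ring
    rw [this, Real.sqrt_sq (by norm_num)]
  set a := √((1 / 2 + (1 - q)) / (2 * (1 / 2 + q)))
  set b := √((1 / 2 + q) / (2 * (1 / 2 + (1 - q))))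
  have hsum : ∀ u w : ℝ, 0 < u → 0 < w → u + w = 2 →
      w / (2 * u) + 2 * (1 / 2) + u / (2 * w) = 2 ^ 2 * (1 / (2 * (u * w))) ∧
      w / (2 * u) * (u - 1 / 2) + u / (2 * w) * (w - 1 / 2)
        + (w / (2 * u) - 2 * (1 / 2) + u / (2 * w)) / 4 = 1 - 1 / (2 * (u * w)) := by
    intro u w hu hw h
    have hu' := hu.ne'
    have hw' := hw.ne'
    obtain rfl : w = 2 - u := by linarith
    constructor <;> field_simp <;> ring
  obtain ⟨i1, i2⟩ := hsum _ _ hu hw (by ring)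
  constructor
  · rw [← sq_eq_sq₀ (by positivity) (by positivity)]
    have : (a + b) ^ 2 = a ^ 2 + 2 * (a * b) + b ^ 2 := by ring
    rw [this, ha2, hb2, hab, mul_pow, hs2, i1]
  · have : (a - b) ^ 2 = a ^ 2 - 2 * (a * b) + b ^ 2 := by ring
    rw [this, ha2, hb2, hab, hs2, ← i2]
    ring

/-- Completing the square: the moment generating function of `N(s x, 1 - s ^ 2)`, weighted by the
density at `x`, becomes a shifted density. -/
lemma gaussianPDF_mul_exp (t s x : ℝ) :
    gaussianPDF 0 1 x * ENNReal.ofReal (Real.exp (t * s * x + t ^ 2 * (1 - s ^ 2) / 2))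
      = ENNReal.ofReal (Real.exp (t ^ 2 / 2)) * gaussianPDF (t * s) 1 x := by
  simp only [gaussianPDF]
  rw [← ENNReal.ofReal_mul (gaussianPDFReal_nonneg _ _ _),
    ← ENNReal.ofReal_mul (Real.exp_nonneg _), gaussianPDFReal_one, gaussianPDFReal_one, mul_assoc,
    mul_left_comm (Real.exp (t ^ 2 / 2)), ← Real.exp_add, ← Real.exp_add]
  congr 3
  ring

lemma measurable_clipCdf (pmin pmax : ℝ) : Measurable (clipCdf pmin pmax) :=
  ((continuous_clip pmin pmax).comp continuous_cdf_gaussianReal).measurable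

lemma measurable_slopeOf : Measurable slopeOf := by
  unfold slopeOf
  fun_prop

/-- The second-batch normals are integrated out first, then `(Z₁ + Z₂) / √2` after a rotation by `π
/ 4`. The sampling probability depends only on the remaining coordinate `(Z₁ - Z₂) / √2`, so it is
constant in both integrations. -/
lemma lintegral_exp_limitVar {pmin pmax : ℝ} (hpmin : 0 < pmin) (hle : pmin ≤ pmax)
    (hpmax : pmax < 1) (t : ℝ) :
    ∫⁻ z, ENNReal.ofReal (Real.exp (t * limitVar pmin pmax z)) ∂stdNormal4
      = ENNReal.ofReal (Real.exp (t ^ 2 / 2)) *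
        ∫⁻ x, gaussianPDF (t * slopeOf (clipCdf pmin pmax x)) 1 x := by
  have hm := measurable_limitVar pmin pmax
  let a : ℝ → ℝ := fun q => √((1 / 2 + (1 - q)) / (2 * (1 / 2 + q)))
  let b : ℝ → ℝ := fun q => √((1 / 2 + q) / (2 * (1 / 2 + (1 - q))))
  have ham : Measurable a := by fun_prop
  have hbm : Measurable b := by fun_prop
  have hcm := measurable_clipCdf pmin pmax
  have hq0 : ∀ x, 0 ≤ clipCdf pmin pmax x := fun x => hpmin.le.trans (le_clip _ _ _)
  have hq1 : ∀ x, clipCdf pmin pmax x ≤ 1 := fun x => (clip_le hle _).trans hpmax.le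
  let V : ℝ → ℝ := fun q => a q ^ 2 * q + b q ^ 2 * (1 - q)
  -- integrate out the errors of the second batch
  have s1 : ∀ x : ℝ × ℝ, ∫⁻ y, ENNReal.ofReal (Real.exp
        (t * limitVar pmin pmax ![x.1, x.2, y.1, y.2])) ∂stdNormal2
      = ENNReal.ofReal (Real.exp (t * (a (clipCdf pmin pmax ((x.1 - x.2) / √2)) * (√(1 / 2) * x.1)
          - b (clipCdf pmin pmax ((x.1 - x.2) / √2)) * (√(1 / 2) * x.2))
          + t ^ 2 * V (clipCdf pmin pmax ((x.1 - x.2) / √2)) / 2)) := fun x => by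
    set q := clipCdf pmin pmax ((x.1 - x.2) / √2) with hq
    have e1 : ∀ y : ℝ × ℝ, t * limitVar pmin pmax ![x.1, x.2, y.1, y.2]
        = t * (a q * (√(1 / 2) * x.1) - b q * (√(1 / 2) * x.2))
          + (t * a q * √q) * y.1 + (-(t * b q * √(1 - q))) * y.2 := fun y => by
      have : piStar pmin pmax ![x.1, x.2, y.1, y.2] = q := rfl
      rw [limitVar, this]
      simp only [a, b, Matrix.cons_val]
      ring
    simp_rw [e1]
    rw [lintegral_exp_stdNormal2]
    congr 2
    have h1 := Real.sq_sqrt (hq0 ((x.1 - x.2) / √2))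
    have h2 := Real.sq_sqrt (sub_nonneg.2 (hq1 ((x.1 - x.2) / √2)))
    rw [← hq] at h1 h2
    rw [neg_sq, mul_pow, mul_pow, mul_pow, mul_pow, h1, h2]
    simp only [V]
    ring
  rw [lintegral_stdNormal4 (by fun_prop)]
  simp_rw [s1]
  rw [lintegral_stdNormal2_rotate (by fun_prop)]
  -- integrate out `(Z₁ + Z₂) / √2`
  have h22 : √2 / 2 * √(1 / 2) = (1 / 2 : ℝ) := by
    rw [div_mul_eq_mul_div, ← Real.sqrt_mul (by norm_num)]
    norm_num
  have s2 : ∀ x : ℝ, ∫⁻ y, ENNReal.ofReal (Real.exp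
        (t * (a (clipCdf pmin pmax ((√2 / 2 * (x + y) - √2 / 2 * (y - x)) / √2))
            * (√(1 / 2) * (√2 / 2 * (x + y)))
          - b (clipCdf pmin pmax ((√2 / 2 * (x + y) - √2 / 2 * (y - x)) / √2))
            * (√(1 / 2) * (√2 / 2 * (y - x))))
          + t ^ 2 * V (clipCdf pmin pmax ((√2 / 2 * (x + y) - √2 / 2 * (y - x)) / √2)) / 2))
          ∂(gaussianReal 0 1)
      = ENNReal.ofReal (Real.exp (t * slopeOf (clipCdf pmin pmax x) * x
          + t ^ 2 * (1 - slopeOf (clipCdf pmin pmax x) ^ 2) / 2)) := fun x => by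
    have e1 : ∀ y : ℝ, (√2 / 2 * (x + y) - √2 / 2 * (y - x)) / √2 = x := fun y => by
      field_simp
      ring
    simp_rw [e1]
    obtain ⟨i1, i2⟩ := slope_identities (hq0 x) (hq1 x)
    set q := clipCdf pmin pmax x
    have e2 : ∀ y : ℝ, t * (a q * (√(1 / 2) * (√2 / 2 * (x + y)))
          - b q * (√(1 / 2) * (√2 / 2 * (y - x)))) + t ^ 2 * V q / 2
        = (t * ((a q + b q) / 2) * x + t ^ 2 * V q / 2) + (t * (a q - b q) / 2) * y := fun y => by
      have : ∀ v : ℝ, √(1 / 2) * (√2 / 2 * v) = 1 / 2 * v := fun v => by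
        rw [← mul_assoc, mul_comm (√(1 / 2)), h22]
      rw [this, this]
      ring
    simp_rw [e2]
    rw [lintegral_exp_gaussianReal]
    congr 2
    rw [← i2, show (a q + b q) = 2 * slopeOf q from i1]
    simp only [V, a, b]
    ring
  simp_rw [s2]
  rw [gaussianReal_of_var_ne_zero _ one_ne_zero, lintegral_withDensity_eq_lintegral_mul _
    (measurable_gaussianPDF _ _) (by have := measurable_slopeOf; fun_prop)]
  simp only [Pi.mul_apply, gaussianPDF_mul_exp]
  rw [lintegral_const_mul']
  exact ENNReal.ofReal_ne_top

/-! ### The limit is not Gaussian -/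

lemma eq_zero_of_tendsto_quadratic {m k : ℝ}
    (h : Tendsto (fun t : ℝ => m * t + k * t ^ 2) atTop (𝓝 0)) : m = 0 ∧ k = 0 := by
  have key : ∀ (c : ℝ) (g : ℝ → ℝ), (∀ t, 1 ≤ t → 1 ≤ g t) →
      Tendsto (fun t => c * g t) atTop (𝓝 0) → c = 0 := by
    intro c g hg hc
    by_contra hne
    have h1 := (Metric.tendsto_nhds.1 hc) |c| (abs_pos.2 hne)
    obtain ⟨t, ht, ht1⟩ := (h1.and (eventually_ge_atTop 1)).exists
    rw [Real.dist_eq, sub_zero, abs_mul] at ht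
    have h2 := hg t ht1
    have h3 : 1 ≤ |g t| := h2.trans (le_abs_self _)
    nlinarith [abs_pos.2 hne]
  have h2 : Tendsto (fun t : ℝ => 2 * t) atTop atTop :=
    tendsto_id.const_mul_atTop (by norm_num)
  -- For `g t = m * t + k * t ^ 2`, the combination `g (2 * t) - 2 * g t = 2 * k * t ^ 2` removes
  -- the linear term.
  have h3 := (h.comp h2).sub (h.const_mul 2)
  have hk : k = 0 := by
    have : 2 * k = 0 := by
      refine key (2 * k) (fun t => t ^ 2) (fun t ht => one_le_pow₀ ht) ?_
      convert! h3 using 1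
      · ext t
        simp only [Function.comp_apply]
        ring
      · simp
    linarith
  refine ⟨key m (fun t => t) (fun t ht => ht) ?_, hk⟩
  simpa [hk] using h

lemma gaussianPDFReal_lt_of_abs_lt {m m' x : ℝ} (h : |x - m| < |x - m'|) :
    gaussianPDFReal m' 1 x < gaussianPDFReal m 1 x := by
  rw [gaussianPDFReal_one, gaussianPDFReal_one]
  have := sq_lt_sq.2 h
  gcongr

lemma gaussianPDF_le_of_abs_le {m m' x : ℝ} (h : |x - m| ≤ |x - m'|) :
    gaussianPDF m' 1 x ≤ gaussianPDF m 1 x := by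
  refine ENNReal.ofReal_le_ofReal ?_
  rw [gaussianPDFReal_one, gaussianPDFReal_one]
  have := sq_le_sq.2 h
  gcongr

lemma gaussianReal_one_Iio (m d : ℝ) :
    gaussianReal m 1 (Set.Iio d) ≤ ENNReal.ofReal (cdf (gaussianReal 0 1) (d - m)) := by
  have h : gaussianReal m 1 = (gaussianReal 0 1).map (fun x => x + m) := by
    rw [gaussianReal_map_add_const, zero_add]
  rw [h, Measure.map_apply (by fun_prop) measurableSet_Iio, ofReal_cdf]
  refine measure_mono fun x hx => ?_
  simp only [Set.mem_preimage, Set.mem_Iio, Set.mem_Iic] at hx ⊢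
  linarith

/-- If the slope `s` is largest, and constant, on a right half line, the integral
`∫ φ(x - t s(x)) dx` of the standard normal density `φ` is not of the form `exp (m t + k t ^ 2)`. -/
lemma lintegral_gaussianPDF_slope_ne {s : ℝ → ℝ} {c d S m k : ℝ} (hs : Measurable s) (hc : 0 < c)
    (hcs : ∀ x, c ≤ s x) (hsS : ∀ x, s x ≤ S) (hd : ∀ x, d ≤ x → s x = S)
    (hpos : volume {x | s x < S} ≠ 0)
    (h : ∀ t, ∫⁻ x, gaussianPDF (t * s x) 1 x = ENNReal.ofReal (Real.exp (m * t + k * t ^ 2))) :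
    False := by
  have hone : ∀ m, ∫⁻ x, gaussianPDF m 1 x = 1 := fun m => lintegral_gaussianPDF_eq_one m one_ne_zero
  have hmeas : ∀ t, Measurable fun x => gaussianPDF (t * s x) 1 x := fun t => by
    have : Measurable fun x => (t * s x, (1 : NNReal), x) := by fun_prop
    exact measurable_uncurry_gaussianPDF.comp this
  have hdist : ∀ t, 0 < t → d ≤ t * c → ∀ x, x < d → x < t * s x ∧ t * c ≤ t * s x ∧
      t * s x ≤ t * S := fun t ht htd x hx => by
    have h1 := mul_le_mul_of_nonneg_left (hcs x) ht.le
    have h2 := mul_le_mul_of_nonneg_left (hsS x) ht.le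
    exact ⟨by linarith, h1, h2⟩
  -- Left of `d` the centres satisfy `x < t * s x ≤ t * S`, so moving the centre from `t * S` to `t
  -- * s x` brings it closer to `x` and raises the density, strictly where `s x < S`. The integral
  -- thus exceeds `1`, the mass of `N(t S, 1)`.
  have hlow : ∀ t, 0 < t → d ≤ t * c → 0 < m * t + k * t ^ 2 := fun t ht htd => by
    have h1 : ∫⁻ x, gaussianPDF (t * S) 1 x < ∫⁻ x, gaussianPDF (t * s x) 1 x := by
      refine lintegral_strict_mono_of_ae_le_of_ae_lt_on (hmeas t).aemeasurable (by simp [hone])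
        (ae_of_all _ fun x => ?_) hpos (ae_of_all _ fun x hx => ?_)
      · rcases lt_or_ge x d with hxd | hxd
        · obtain ⟨h1, -, h3⟩ := hdist t ht htd x hxd
          refine gaussianPDF_le_of_abs_le ?_
          rw [abs_of_neg (by linarith), abs_of_neg (by linarith)]
          linarith
        · simp only [hd x hxd, le_refl]
      · have hx' : s x < S := hx
        have hxd : x < d := lt_of_not_ge fun hxd => hx'.ne (hd x hxd)
        obtain ⟨h1, -, h3⟩ := hdist t ht htd x hxd
        have h4 := mul_lt_mul_of_pos_left hx' ht
        refine (ENNReal.ofReal_lt_ofReal_iff (gaussianPDFReal_pos _ _ _ one_ne_zero)).2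
          (gaussianPDFReal_lt_of_abs_lt ?_)
        rw [abs_of_neg (by linarith), abs_of_neg (by linarith)]
        linarith
    rw [hone, h, ENNReal.one_lt_ofReal, Real.one_lt_exp_iff] at h1
    exact h1
  -- Right of `d` the integrand is the density of `N(t S, 1)`; left of `d` it is at most that of
  -- `N(t c, 1)`, whose mass there is a vanishing tail. The inequality `y + 1 ≤ exp y` passes from
  -- the exponential to its exponent.
  have hup : ∀ t, 0 < t → d ≤ t * c →
      m * t + k * t ^ 2 ≤ cdf (gaussianReal 0 1) (d - t * c) := fun t ht htd => by
    have h1 : ∫⁻ x, gaussianPDF (t * s x) 1 x ≤ ∫⁻ x, (gaussianPDF (t * S) 1 x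
        + (Set.Iio d).indicator (gaussianPDF (t * c) 1) x) := by
      refine lintegral_mono fun x => ?_
      rcases lt_or_ge x d with hxd | hxd
      · obtain ⟨h1, h2, -⟩ := hdist t ht htd x hxd
        rw [Set.indicator_of_mem (Set.mem_Iio.2 hxd)]
        refine le_add_left (gaussianPDF_le_of_abs_le ?_)
        rw [abs_of_neg (by linarith), abs_of_neg (by linarith)]
        linarith
      · rw [hd x hxd]
        exact le_self_add
    rw [lintegral_add_left (measurable_gaussianPDF _ _), hone,
      lintegral_indicator measurableSet_Iio, ← gaussianReal_apply _ one_ne_zero, h] at h1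
    have h2 := h1.trans (add_le_add_right (gaussianReal_one_Iio (t * c) d) 1)
    rw [← ENNReal.ofReal_one, ← ENNReal.ofReal_add zero_le_one (cdf_nonneg _ _),
      ENNReal.ofReal_le_ofReal_iff (add_nonneg zero_le_one (cdf_nonneg _ _))] at h2
    linarith [Real.add_one_le_exp (m * t + k * t ^ 2)]
  have hev : ∀ᶠ t in atTop, 0 < t ∧ d ≤ t * c := by
    filter_upwards [eventually_gt_atTop 0, eventually_ge_atTop (d / c)] with t ht htd
    exact ⟨ht, (div_le_iff₀ hc).1 htd⟩
  have hlim : Tendsto (fun t : ℝ => m * t + k * t ^ 2) atTop (𝓝 0) := by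
    have h1 : Tendsto (fun t : ℝ => d - t * c) atTop atBot := by
      have := tendsto_atBot_add_const_left atTop d
        (tendsto_neg_atTop_atBot.comp (tendsto_id.atTop_mul_const hc))
      simpa [sub_eq_add_neg] using this
    refine tendsto_of_tendsto_of_tendsto_of_le_of_le' tendsto_const_nhds
      ((tendsto_cdf_atBot (gaussianReal 0 1)).comp h1) ?_ ?_
    · filter_upwards [hev] with t ht using (hlow t ht.1 ht.2).le
    · filter_upwards [hev] with t ht using hup t ht.1 ht.2
  obtain ⟨hm, hk⟩ := eq_zero_of_tendsto_quadratic hlim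
  obtain ⟨t, ht⟩ := hev.exists
  have := hlow t ht.1 ht.2
  simp [hm, hk] at this

/-- The product under the root at `q` minus the one at `r` equals `(q - r) * (1 - q - r)`: the slope
grows with the distance of the probability from `1/2`. -/
lemma slopeOf_le {q r : ℝ} (hr0 : 0 ≤ r) (hr1 : r ≤ 1) (h : 0 ≤ (q - r) * (1 - q - r)) :
    slopeOf q ≤ slopeOf r := by
  have h1 : 0 < (1 / 2 + r) * (1 / 2 + (1 - r)) := mul_pos (by linarith) (by linarith)
  have h2 : (1 / 2 + r) * (1 / 2 + (1 - r)) ≤ (1 / 2 + q) * (1 / 2 + (1 - q)) := by linarith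
  unfold slopeOf
  gcongr

lemma slopeOf_lt {q r : ℝ} (hr0 : 0 ≤ r) (hr1 : r ≤ 1) (h : 0 < (q - r) * (1 - q - r)) :
    slopeOf q < slopeOf r := by
  have h1 : 0 < (1 / 2 + r) * (1 / 2 + (1 - r)) := mul_pos (by linarith) (by linarith)
  have h2 : (1 / 2 + r) * (1 / 2 + (1 - r)) < (1 / 2 + q) * (1 / 2 + (1 - q)) := by linarith
  have h3 := h1.trans h2
  unfold slopeOf
  refine Real.sqrt_lt_sqrt (by positivity) ?_
  gcongr

lemma le_slopeOf {q : ℝ} (h0 : 0 ≤ q) (h1 : q ≤ 1) : √(1 / 2) ≤ slopeOf q := by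
  have h2 : 0 < (1 / 2 + q) * (1 / 2 + (1 - q)) := mul_pos (by linarith) (by linarith)
  have h3 : (1 / 2 + q) * (1 / 2 + (1 - q)) ≤ 1 := by nlinarith [sq_nonneg (q - 1 / 2)]
  unfold slopeOf
  refine Real.sqrt_le_sqrt ?_
  rw [div_le_div_iff₀ (by norm_num) (by positivity)]
  linarith

theorem map_limitVar_ne_gaussianReal {pmin pmax : ℝ} (hpmin : 0 < pmin) (hlt : pmin < pmax)
    (hpmax : pmax < 1) (m : ℝ) (v : NNReal) :
    stdNormal4.map (limitVar pmin pmax) ≠ gaussianReal m v := by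
  intro hY
  have hq0 : ∀ x, 0 ≤ clipCdf pmin pmax x := fun x => hpmin.le.trans (le_clip _ _ _)
  have hq1 : ∀ x, clipCdf pmin pmax x ≤ 1 := fun x => (clip_le hlt.le _).trans hpmax.le
  have hlo : ∀ x, pmin ≤ clipCdf pmin pmax x := fun x => le_clip _ _ _
  have hhi : ∀ x, clipCdf pmin pmax x ≤ pmax := fun x => clip_le hlt.le _
  have hmgf : ∀ t, ∫⁻ x, gaussianPDF (t * slopeOf (clipCdf pmin pmax x)) 1 x
      = ENNReal.ofReal (Real.exp (m * t + ((v : ℝ) / 2 - 1 / 2) * t ^ 2)) := fun t => by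
    have h1 := lintegral_exp_limitVar hpmin hlt.le hpmax t
    have hm := measurable_limitVar pmin pmax
    rw [← lintegral_map (f := fun y => ENNReal.ofReal (Real.exp (t * y))) (by fun_prop) hm, hY,
      ← ofReal_integral_eq_lintegral_ofReal (integrable_exp_mul_gaussianReal t)
        (ae_of_all _ fun x => (Real.exp_pos _).le)] at h1
    have h2 := congrFun (mgf_fun_id_gaussianReal (μ := m) (v := v)) t
    rw [mgf] at h2
    rw [h2] at h1
    have h3 : m * t + v * t ^ 2 / 2 = t ^ 2 / 2 + (m * t + ((v : ℝ) / 2 - 1 / 2) * t ^ 2) := by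
      ring
    rw [h3, Real.exp_add, ENNReal.ofReal_mul (Real.exp_nonneg _)] at h1
    exact ((ENNReal.mul_right_inj (by simp [Real.exp_pos]) ENNReal.ofReal_ne_top).1 h1).symm
  have hsm : Measurable fun x => slopeOf (clipCdf pmin pmax x) :=
    measurable_slopeOf.comp (measurable_clipCdf pmin pmax)
  -- an open set on which the clipping is inactive
  let U : Set ℝ := cdf (gaussianReal 0 1) ⁻¹' Set.Ioo pmin pmax
  have hU : IsOpen U := isOpen_Ioo.preimage continuous_cdf_gaussianReal
  have hUq : ∀ x ∈ U, pmin < clipCdf pmin pmax x ∧ clipCdf pmin pmax x < pmax := fun x hx => by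
    have : clipCdf pmin pmax x = cdf (gaussianReal 0 1) x := by
      rw [clipCdf, clip, min_eq_right hx.2.le, max_eq_right hx.1.le]
    rw [this]
    exact hx
  have hUne : U.Nonempty := by
    obtain ⟨x₀, hx₀⟩ := ((tendsto_cdf_atBot (gaussianReal 0 1)).eventually_lt_const
      (show (0 : ℝ) < (pmin + pmax) / 2 by linarith)).exists
    obtain ⟨x₁, hx₁⟩ := ((tendsto_cdf_atTop (gaussianReal 0 1)).eventually_const_lt
      (show (pmin + pmax) / 2 < (1 : ℝ) by linarith)).exists
    obtain ⟨x, hx⟩ := mem_range_of_exists_le_of_exists_ge continuous_cdf_gaussianReal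
      ⟨x₀, hx₀.le⟩ ⟨x₁, hx₁.le⟩
    exact ⟨x, by simp only [U, Set.mem_preimage, hx, Set.mem_Ioo]; constructor <;> linarith⟩
  -- The case distinction decides which clipping bound is at least as far from `1/2` as the other:
  -- the slope is maximal there. The upper bound is attained on a right half line, the lower one on
  -- a left half line.
  rcases le_total 1 (pmin + pmax) with hcase | hcase
  · obtain ⟨d, hd⟩ := eventually_atTop.1
      ((tendsto_cdf_atTop (gaussianReal 0 1)).eventually_const_lt hpmax)
    refine lintegral_gaussianPDF_slope_ne hsm (Real.sqrt_pos.2 (by norm_num : (0 : ℝ) < 1 / 2))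
      (fun x => le_slopeOf (hq0 x) (hq1 x)) (S := slopeOf pmax) (d := d) (fun x => ?_)
      (fun x hx => ?_) ?_ hmgf
    · refine slopeOf_le (by linarith) hpmax.le ?_
      exact mul_nonneg_of_nonpos_of_nonpos (by linarith [hhi x]) (by linarith [hlo x])
    · rw [clipCdf, clip, min_eq_left (hd x hx).le, max_eq_right hlt.le]
    · refine ne_bot_of_le_ne_bot (hU.measure_ne_zero volume hUne) (measure_mono fun x hx => ?_)
      obtain ⟨h1, h2⟩ := hUq x hx
      refine slopeOf_lt (by linarith) hpmax.le ?_
      exact mul_pos_of_neg_of_neg (by linarith) (by linarith)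
  · obtain ⟨d, hd⟩ := eventually_atBot.1
      ((tendsto_cdf_atBot (gaussianReal 0 1)).eventually_lt_const hpmin)
    -- Reflecting `x` turns the left half line into a right one and exchanges `t` with `-t`, hence
    -- `m` with `-m`.
    refine lintegral_gaussianPDF_slope_ne (s := fun x => slopeOf (clipCdf pmin pmax (-x)))
      (hsm.comp measurable_neg)
      (Real.sqrt_pos.2 (by norm_num : (0 : ℝ) < 1 / 2)) (m := -m) (k := (v : ℝ) / 2 - 1 / 2)
      (fun x => le_slopeOf (hq0 _) (hq1 _)) (S := slopeOf pmin) (d := -d) (fun x => ?_)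
      (fun x hx => ?_) ?_ fun t => ?_
    · refine slopeOf_le hpmin.le (by linarith) ?_
      exact mul_nonneg (by linarith [hlo (-x)]) (by linarith [hhi (-x)])
    · have h1 := hd (-x) (by linarith)
      rw [clipCdf, clip, max_eq_left ((min_le_right _ _).trans h1.le)]
    · refine ne_bot_of_le_ne_bot ((hU.preimage continuous_neg).measure_ne_zero volume ?_)
        (measure_mono fun x hx => ?_)
      · obtain ⟨x, hx⟩ := hUne
        exact ⟨-x, by simpa using hx⟩
      · obtain ⟨h1, h2⟩ := hUq (-x) hx
        refine slopeOf_lt hpmin.le (by linarith) ?_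
        exact mul_pos (by linarith) (by linarith)
    · have h1 := hmgf (-t)
      rw [← lintegral_neg_eq_self] at h1
      have h2 : ∀ x : ℝ, gaussianPDF (-t * slopeOf (clipCdf pmin pmax (-x))) 1 (-x)
          = gaussianPDF (t * slopeOf (clipCdf pmin pmax (-x))) 1 x := fun x => by
        rw [gaussianPDF, gaussianPDF, gaussianPDFReal_one, gaussianPDFReal_one]
        congr 4
        ring
      simp_rw [h2] at h1
      rw [h1]
      congr 2
      ring

end BatchedBandit

open BatchedBandit in
theorem mainTheorem2 {Ω : ℕ → Type*} [∀ n, MeasurableSpace (Ω n)]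
    (P : (n : ℕ) → Measure (Ω n)) [∀ n, IsProbabilityMeasure (P n)]
    (pmin pmax : ℝ) (hpmin : 0 < pmin) (hle : pmin ≤ pmax) (hpmax : pmax < 1)
    (β : Fin 2 → ℝ)
    (A : (n : ℕ) → Fin 2 → Fin n → Ω n → Fin 2) (R : (n : ℕ) → Fin 2 → Fin n → Ω n → ℝ)
    (hbandit : ∀ n, IsGaussianBandit (P n) β (thompsonProb pmin pmax (A n) (R n)) (A n) (R n))
    (hmargin : β 1 - β 0 = 0) :
    TendstoInDistribution (fun n => zStat 1 β (A n) (R n)) atTop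
        (limitVar pmin pmax) P stdNormal4 ∧
      (pmin < pmax → ∀ (m : ℝ) (v : NNReal),
        stdNormal4.map (limitVar pmin pmax) ≠ gaussianReal m v ∧
        ¬ TendstoInDistribution (fun n => zStat 1 β (A n) (R n)) atTop
            (id : ℝ → ℝ) P (gaussianReal m v)) := by
  have hconv := tendstoInDistribution_zStat P hpmin hle hpmax β A R hbandit (sub_eq_zero.1 hmargin)
  refine ⟨hconv, fun hlt m v => ?_⟩
  have hne := map_limitVar_ne_gaussianReal hpmin hlt hpmax m v
  refine ⟨hne, fun h => hne ?_⟩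
  -- Limits in distribution are unique, so a Gaussian limit would have to be the law of `limitVar`.
  rw [tendstoInDistribution_unique _ hconv h, Measure.map_id]
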